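/- Let $\mathbf H$ be a real or complex Hilbert space with inner product $(\cdot,\cdot)$ and norm $\|\cdot\|$, let $A$ be a self-adjoint positive-definite (possibly unbounded) linear operator in $\mathbf H$ with dense domain $D(A)$ and compact inverse, and put $\|w\|_q=(A^qw,w)^{1/2}=\|A^{q/2}w\|$. Let $m\ge 1$ and let $B_1,\dots,B_m$ be self-adjoint linear operators in $\mathbf H$ with $D(A)\subset D(B_j)$ that are dominated by $A$: there is a constant $C_0$ with $$|(B_jw,v)|\le C_0\|w\|_q\|v\|_\vartheta\qquad (w,v\in D(A),\ \vartheta=0,1,2,\ \vartheta+q=2).$$ Let $0<\alpha_j<1$, $\alpha=\min_{1\le j\le m}\alpha_j$, $\kappa\ge 0$, $0<T<\infty$, $\beta_j(t)=e^{-\kappa t}t^{\alpha_j-1}/\Gamma(\alpha_j)$, and let $E(t)=\exp(-tA)$ be the semigroup generated by $-A$. For $u_0\in D(A)$ and $f:[0,T]\to\mathbf H$ consider the problem $$u'(t)+Au(t)+\sum_{j=1}^m\int_0^t\beta_j(t-s)B_ju(s)\,ds=f(t)\quad(0<t\le T),\qquad u(0)=u_0. \tag{1}$$ Here a solution is a continuous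 $u:[0,T]\to\mathbf H$ that is differentiable on $(0,T]$, takes values in $D(A)$ there, has integrable functions $s\mapsto\beta_j(t-s)B_ju(s)$ on $(0,t)$, and satisfies (1) (derivatives at $t=T$ are one-sided). Put $g(t)=e^{\kappa t}f(t)$, and suppose that $g$ is continuous on $[0,T]$ and twice differentiable on $(0,T]$, and that for some constant $M$ and all $0<t\le T$ $$\|Au_0-g(0)\|+\|g(t)\|\le M,\qquad \|E'(t)(Au_0-g(0))\|+\|g'(t)\|+t\|g''(t)\|\le Mt^{\alpha-1}.$$ Then every solution $u$ of (1) is twice differentiable on $(0,T]$ with $u'(t)\in D(A)$, provided $u_0\ne 0$ or $M=0$, and $$\|u''(t)\|+\|Au'(t)\|\le C\,e^{-\kappa t}\,t^{\alpha-1}\,\|u_0\|_2,\qquad 0<t\le T,$$ where $C$ depends only on $A$, $B_1,\dots,B_m$, $\alpha_1,\dots,\alpha_m$, $\kappa$, $T$ and an upper bound $R$ for the ratio $M/\|u_0\|_2$; that is, for every $R$ one constant $C>0$ serves for all $u_0,f,u,M$ as above with $M\le R\|u_0\|_2$. (For $u_0\ne0$ the inequality $M\le R\|u_0\|_2$ always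 holds with $R=M/\|u_0\|_2$, so it is no restriction on the data.) -/

import Mathlib

open Set MeasureTheory

noncomputable section

namespace TemperedVolterra

variable {𝕜 H : Type*} [RCLike 𝕜] [NormedAddCommGroup H] [InnerProductSpace 𝕜 H]

open Classical in
/-- The value `A x` of an unbounded operator as a function on the whole space, with the value `0`
outside the domain of `A`. Wherever it is used, membership in the domain is required separately. -/
def app (A : H →ₗ.[𝕜] H) (x : H) : H :=
  if hx : x ∈ A.domain then A ⟨x, hx⟩ else 0

/-- `A` is a self-adjoint positive-definite (possibly unbounded) densely defined linear operator
with compact inverse. (Density of the domain is part of `IsSelfAdjoint` for `LinearPMap`.) -/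
structure IsAdmissible [CompleteSpace H] (A : H →ₗ.[𝕜] H) : Prop where
  selfAdjoint : IsSelfAdjoint A
  posDef : ∀ x : A.domain, x ≠ 0 → 0 < RCLike.re (inner 𝕜 (A x) (x : H))
  compactInverse : ∃ K : H →L[𝕜] H, IsCompactOperator K ∧
    (∀ x : A.domain, K (A x) = x) ∧ ∀ y : H, ∃ h : K y ∈ A.domain, A ⟨K y, h⟩ = y

/-- The norm `‖x‖_q = ‖A^{q/2} x‖ = (A^q x, x)^{1/2}`, with `(A^q x, x)` written in the symmetric
form `(A^{⌈q/2⌉} x, A^{⌊q/2⌋} x)`, which makes sense for `x ∈ D(A^{⌈q/2⌉})`. Thus on `D(A)` it is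
`‖x‖`, `(A x, x)^{1/2}` and `‖A x‖` for `q = 0, 1, 2`. -/
def scaleNorm (A : H →ₗ.[𝕜] H) (q : ℕ) (x : H) : ℝ :=
  Real.sqrt (RCLike.re (inner 𝕜 ((app A)^[(q + 1) / 2] x) ((app A)^[q / 2] x)))

/-- `A` dominates `B`: `D(A) ⊆ D(B)` and `|(B w, v)| ≤ C ‖w‖_q ‖v‖_ϑ` for `ϑ = 0, 1, 2`,
`ϑ + q = 2`. -/
def Dominates (A B : H →ₗ.[𝕜] H) : Prop :=
  A.domain ≤ B.domain ∧
    ∃ C : ℝ, ∀ w ∈ A.domain, ∀ v ∈ A.domain, ∀ ϑ q : ℕ, ϑ + q = 2 →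
      ‖inner 𝕜 (app B w) v‖ ≤ C * scaleNorm A q w * scaleNorm A ϑ v

/-- The eigenspace `{x ∈ D(A) | A x = μ x}`. -/
def eigenspace (A : H →ₗ.[𝕜] H) (μ : ℝ) : Submodule 𝕜 H :=
  (LinearMap.ker (A.toFun - (μ : 𝕜) • A.domain.subtype)).map A.domain.subtype

/-- The semigroup `E(t) = exp(-tA)`, through the spectral decomposition of `A`:
`E(t) x = ∑_μ exp(-tμ) P_μ x`, where `P_μ` is the orthogonal projection onto the eigenspace of `μ`.
(An operator with compact inverse has pure point spectrum; the eigenspaces of a self-adjoint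
operator are closed, so that taking the closure changes nothing.) -/
def semigroup [CompleteSpace H] (A : H →ₗ.[𝕜] H) (t : ℝ) (x : H) : H :=
  ∑' μ : ℝ, ((Real.exp (-(t * μ)) : ℝ) : 𝕜) • (eigenspace A μ).topologicalClosure.starProjection x

/-- The tempered kernel `β(t) = e^{-κt} t^{a-1} / Γ(a)`. -/
def kernel (κ a t : ℝ) : ℝ :=
  Real.exp (-κ * t) * t ^ (a - 1) / Real.Gamma a

section Real

variable [NormedSpace ℝ H]

/-- `u` is a (classical) solution on `[0, T]` of
`u' + A u + ∑_j ∫_0^t β_j(t-s) B_j u(s) ds = f` for `0 < t ≤ T`, `u(0) = u₀`. -/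
structure IsSolution {m : ℕ} (A : H →ₗ.[𝕜] H) (B : Fin m → H →ₗ.[𝕜] H) (α : Fin m → ℝ) (κ T : ℝ)
    (f : ℝ → H) (u₀ : H) (u : ℝ → H) : Prop where
  continuousOn : ContinuousOn u (Icc 0 T)
  initial : u 0 = u₀
  differentiableOn : DifferentiableOn ℝ u (Ioc 0 T)
  mem_domain : ∀ t ∈ Ioc 0 T, u t ∈ A.domain
  integrable : ∀ j, ∀ t ∈ Ioc 0 T,
    IntervalIntegrable (fun s => kernel κ (α j) (t - s) • app (B j) (u s)) volume 0 t
  equation : ∀ t ∈ Ioc 0 T,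
    derivWithin u (Ioc 0 T) t + app A (u t) +
      ∑ j, ∫ s in (0 : ℝ)..t, kernel κ (α j) (t - s) • app (B j) (u s) = f t

/-- The assumptions on the data, with constant `M`: `u₀ ∈ D(A)`, `g` is continuous on `[0, T]`,
twice differentiable on `(0, T]`, and for `0 < t ≤ T`
`‖A u₀ - g(0)‖ + ‖g(t)‖ ≤ M` and
`‖E'(t) (A u₀ - g(0))‖ + ‖g'(t)‖ + t ‖g''(t)‖ ≤ M t^{a-1}`. -/
structure DataBound [CompleteSpace H] (A : H →ₗ.[𝕜] H) (a T : ℝ) (u₀ : H) (g : ℝ → H)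
    (M : ℝ) : Prop where
  mem_domain : u₀ ∈ A.domain
  continuousOn : ContinuousOn g (Icc 0 T)
  differentiableOn : DifferentiableOn ℝ g (Ioc 0 T)
  differentiableOn_deriv : DifferentiableOn ℝ (derivWithin g (Ioc 0 T)) (Ioc 0 T)
  bound : ∀ t ∈ Ioc 0 T, ‖app A u₀ - g 0‖ + ‖g t‖ ≤ M
  bound_deriv : ∀ t ∈ Ioc 0 T,
    ‖deriv (fun s => semigroup A s (app A u₀ - g 0)) t‖ + ‖derivWithin g (Ioc 0 T) t‖
      + t * ‖derivWithin (derivWithin g (Ioc 0 T)) (Ioc 0 T) t‖ ≤ M * t ^ (a - 1)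

end Real

end TemperedVolterra

end

/-! Write `K` for the inverse of `A`, `E(t) = exp(-tA)`, `G = A E`, `y₀ = A u₀`. Formal
differentiation of the equation gives, for `w = u'` and `z = A u'`, the problem `w' + z + b * z =
φ`, `w(0) = f(0) - y₀`, where `b = ∑ β_j B_j K` and `φ = f' - b(·) y₀`. Both bounds of the theorem
follow once `z` is shown to be `O(t^{α-1})`: then `A u' = z` and `u'' = φ - b * z - z`.

Duhamel's formula turns this into `z = G w(0) + A(E * φ) - A(E * b) * z`. The norm of `G` is only
bounded by `1/t`, which is not integrable. But `b` and `φ` are of size `t^{α-1}` with Lipschitz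
constant `s^{α-2}` on `[s, T]`, and subtracting the value at the endpoint cancels the singularity of
`G`, so that `A(E * φ)` and the operator kernel `A(E * b)` are again `O(t^{α-1})`
(`weaklySingular_smoothed`, also used for operator-valued functions through
`SmoothingFamily.compL`). What remains is a Volterra equation of the second kind with a weakly
singular kernel, solved by contraction in the norm with weight `t^{α-1} e^{λt}` for large `λ`
(`exists_volterra`).

To connect `z` with the given solution, `K` is applied to the equation and the result is integrated.
Each `B_j K` is bounded by domination, and its adjoint extends `K B_j` to the whole space
(`Dominates.exists_bounded`), so only bounded operators remain, and every classical solution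
satisfies the integrated equation (`IsSolution.integrated_equation`). The function `K(y₀ + ∫ z)`
satisfies it too, and uniqueness (`eq_zero_of_homogeneous`) identifies it with `u`; hence `u' = K
z`. These steps are joined in `regularity`.

The semigroup properties come from the spectral decomposition of `A` (`smoothingFamily`). On the
finite interval the factor `e^{-κt}` costs only `e^{κT}` in the constant. -/

set_option linter.unusedSectionVars false

/-! ### Weakly singular functions and Volterra convolutions. -/

namespace TemperedVolterra

variable {Y Z : Type*} [NormedAddCommGroup Y] [NormedSpace ℝ Y]
  [NormedAddCommGroup Z] [NormedSpace ℝ Z]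

/-- Functions that are continuous on `(0, T]` and bounded there by `c t^{α-1}`. -/
structure WeaklySingular (α T c : ℝ) (h : ℝ → Y) : Prop where
  cont : ContinuousOn h (Ioc 0 T)
  bound : ∀ t ∈ Ioc 0 T, ‖h t‖ ≤ c * t ^ (α - 1)

/-- The Volterra convolution `∫_0^t k(t-s) h(s) ds`. -/
noncomputable def conv (k : ℝ → Y →L[ℝ] Z) (h : ℝ → Y) (t : ℝ) : Z :=
  ∫ s in (0 : ℝ)..t, k (t - s) (h s)

/-- The beta integral. -/
noncomputable def betaInt (p q : ℝ) : ℝ :=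
  ∫ σ in (0 : ℝ)..1, (1 - σ) ^ (p - 1) * σ ^ (q - 1)

lemma half_rpow_le {p x : ℝ} (hp0 : 0 < p) (hp1 : p ≤ 1) (hx : 1 / 2 ≤ x) :
    x ^ (p - 1) ≤ 2 := by
  calc x ^ (p - 1) ≤ (1 / 2 : ℝ) ^ (p - 1) :=
        Real.rpow_le_rpow_of_nonpos (by norm_num) hx (by linarith)
    _ = (2 : ℝ) ^ (1 - p) := by
        rw [one_div, Real.inv_rpow (by norm_num), ← Real.rpow_neg (by norm_num)]
        ring_nf
    _ ≤ (2 : ℝ) ^ (1 : ℝ) := Real.rpow_le_rpow_of_exponent_le (by norm_num) (by linarith)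
    _ = 2 := by simp

/-- On each half of `[0, 1]` only one factor can be singular, and the other is at most `2`. The
right-hand side is visibly integrable. -/
lemma beta_integrand_le {p q σ : ℝ} (hp0 : 0 < p) (hp1 : p ≤ 1) (hq0 : 0 < q) (hq1 : q ≤ 1)
    (h0 : 0 ≤ σ) (h1 : σ ≤ 1) :
    (1 - σ) ^ (p - 1) * σ ^ (q - 1) ≤ 2 * (1 - σ) ^ (p - 1) + 2 * σ ^ (q - 1) := by
  have a := Real.rpow_nonneg h0 (q - 1)
  have b := Real.rpow_nonneg (sub_nonneg.2 h1) (p - 1)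
  rcases le_total (1 / 2) σ with h | h
  · have := half_rpow_le hq0 hq1 h
    nlinarith
  · have := half_rpow_le hp0 hp1 (x := 1 - σ) (by linarith)
    nlinarith

lemma intervalIntegrable_rpow_sub_one {p : ℝ} (hp : 0 < p) (a b : ℝ) :
    IntervalIntegrable (fun x : ℝ => x ^ (p - 1)) volume a b :=
  intervalIntegral.intervalIntegrable_rpow' (by linarith)

lemma intervalIntegrable_beta {p q : ℝ} (hp0 : 0 < p) (hp1 : p ≤ 1) (hq0 : 0 < q) (hq1 : q ≤ 1) :
    IntervalIntegrable (fun σ : ℝ => (1 - σ) ^ (p - 1) * σ ^ (q - 1)) volume 0 1 := by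
  have h1 : IntervalIntegrable (fun σ : ℝ => (1 - σ) ^ (p - 1)) volume 0 1 := by
    simpa using ((intervalIntegrable_rpow_sub_one hp0 0 1).comp_sub_left 1).symm
  have h2 := intervalIntegrable_rpow_sub_one hq0 0 1
  refine ((h1.const_mul 2).add (h2.const_mul 2)).mono_fun
    (by fun_prop : Measurable _).aestronglyMeasurable ?_
  refine (ae_restrict_iff' measurableSet_uIoc).2 (ae_of_all _ fun σ hσ => ?_)
  rw [uIoc_of_le zero_le_one] at hσ
  have a := Real.rpow_nonneg hσ.1.le (q - 1)
  have b := Real.rpow_nonneg (sub_nonneg.2 hσ.2) (p - 1)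
  simp only
  rw [Real.norm_of_nonneg (by positivity), Real.norm_of_nonneg (by positivity)]
  exact beta_integrand_le hp0 hp1 hq0 hq1 hσ.1.le hσ.2

lemma betaInt_nonneg (p q : ℝ) : 0 ≤ betaInt p q :=
  intervalIntegral.integral_nonneg zero_le_one fun _ hσ =>
    mul_nonneg (Real.rpow_nonneg (sub_nonneg.2 hσ.2) _) (Real.rpow_nonneg hσ.1 _)

lemma aestronglyMeasurable_Ioc {h : ℝ → Y} {T t : ℝ} (hc : ContinuousOn h (Ioc 0 T))
    (ht : t ≤ T) : AEStronglyMeasurable h (volume.restrict (Ioc 0 t)) :=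
  (hc.mono (Ioc_subset_Ioc_right ht)).aestronglyMeasurable measurableSet_Ioc

lemma aestronglyMeasurable_Ioc_of_Ioo {h : ℝ → Y} {a b : ℝ} (hc : ContinuousOn h (Ioo a b)) :
    AEStronglyMeasurable h (volume.restrict (Ioc a b)) := by
  rw [← Measure.restrict_congr_set (Ioo_ae_eq_Ioc (μ := volume) (a := a) (b := b))]
  exact hc.aestronglyMeasurable measurableSet_Ioo

namespace WeaklySingular

variable {α T c : ℝ} {h : ℝ → Y}

lemma const_nonneg (hh : WeaklySingular α T c h) (hT : 0 < T) : 0 ≤ c := by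
  have := (norm_nonneg _).trans (hh.bound T ⟨hT, le_rfl⟩)
  exact nonneg_of_mul_nonneg_left this (Real.rpow_pos_of_pos hT _)

lemma mono_const {c' : ℝ} (hh : WeaklySingular α T c h) (hc : c ≤ c') :
    WeaklySingular α T c' h :=
  ⟨hh.cont, fun t ht => (hh.bound t ht).trans
    (mul_le_mul_of_nonneg_right hc (Real.rpow_nonneg ht.1.le _))⟩

lemma add {c' : ℝ} {h' : ℝ → Y} (hh : WeaklySingular α T c h) (hh' : WeaklySingular α T c' h') :
    WeaklySingular α T (c + c') (fun t => h t + h' t) :=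
  ⟨hh.cont.add hh'.cont, fun t ht => (norm_add_le _ _).trans
    ((add_le_add (hh.bound t ht) (hh'.bound t ht)).trans_eq (add_mul _ _ _).symm)⟩

lemma neg (hh : WeaklySingular α T c h) : WeaklySingular α T c (fun t => -h t) :=
  ⟨hh.cont.neg, fun t ht => by rw [norm_neg]; exact hh.bound t ht⟩

lemma sub {c' : ℝ} {h' : ℝ → Y} (hh : WeaklySingular α T c h) (hh' : WeaklySingular α T c' h') :
    WeaklySingular α T (c + c') (fun t => h t - h' t) := by
  simpa [sub_eq_add_neg] using hh.add hh'.neg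

lemma clm_apply (hh : WeaklySingular α T c h) (L : Y →L[ℝ] Z) :
    WeaklySingular α T (‖L‖ * c) (fun t => L (h t)) :=
  ⟨L.continuous.comp_continuousOn hh.cont, fun t ht => (L.le_opNorm _).trans (by
    rw [mul_assoc]; exact mul_le_mul_of_nonneg_left (hh.bound t ht) (norm_nonneg _))⟩

lemma one_le_rpow (hα : α ≤ 1) {t : ℝ} (ht : t ∈ Ioc 0 T) :
    1 ≤ T ^ (1 - α) * t ^ (α - 1) := by
  have h1 : T ^ (α - 1) ≤ t ^ (α - 1) := Real.rpow_le_rpow_of_nonpos ht.1 ht.2 (by linarith)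
  have h2 : T ^ (1 - α) * T ^ (α - 1) = 1 := by
    rw [← Real.rpow_add (ht.1.trans_le ht.2)]; simp
  refine h2.symm.le.trans ?_
  exact mul_le_mul_of_nonneg_left h1 (Real.rpow_nonneg (ht.1.trans_le ht.2).le _)

lemma of_bounded (hα : α ≤ 1) (hc : ContinuousOn h (Ioc 0 T)) (hc0 : 0 ≤ c)
    (hb : ∀ t ∈ Ioc 0 T, ‖h t‖ ≤ c) : WeaklySingular α T (c * T ^ (1 - α)) h :=
  ⟨hc, fun t ht => (hb t ht).trans (by
    rw [mul_assoc]; exact le_mul_of_one_le_right hc0 (one_le_rpow hα ht))⟩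

lemma intervalIntegrable (hh : WeaklySingular α T c h) (hα : 0 < α) {t : ℝ} (h0 : 0 ≤ t)
    (ht : t ≤ T) : IntervalIntegrable h volume 0 t := by
  refine ((intervalIntegrable_rpow_sub_one hα 0 t).const_mul c).mono_fun ?_ ?_
  · rw [uIoc_of_le h0]
    exact aestronglyMeasurable_Ioc hh.cont ht
  · refine (ae_restrict_iff' measurableSet_uIoc).2 (ae_of_all _ fun s hs => ?_)
    rw [uIoc_of_le h0] at hs
    exact (hh.bound s ⟨hs.1, hs.2.trans ht⟩).trans (le_abs_self _)

end WeaklySingular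

/-- The substitution `s = tσ` fixes the interval of integration, so that continuity in `t` becomes a
matter of dominated convergence and power bounds become beta integrals. -/
lemma conv_eq_scaled (k : ℝ → Y →L[ℝ] Z) (h : ℝ → Y) (t : ℝ) :
    conv k h t = t • ∫ σ in (0 : ℝ)..1, k (t * (1 - σ)) (h (t * σ)) := by
  have := intervalIntegral.smul_integral_comp_mul_left (a := 0) (b := 1)
    (fun s => k (t - s) (h s)) t
  simp only [mul_zero, mul_one] at this
  rw [conv, ← this]
  simp only [mul_sub, mul_one]

lemma conv_congr {k k' : ℝ → Y →L[ℝ] Z} {h h' : ℝ → Y} {T t : ℝ} (hk : EqOn k k' (Ioc 0 T))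
    (hh : EqOn h h' (Ioc 0 T)) (ht : t ∈ Ioc 0 T) : conv k h t = conv k' h' t := by
  rw [conv, conv, intervalIntegral.integral_of_le ht.1.le, intervalIntegral.integral_of_le ht.1.le,
    integral_Ioc_eq_integral_Ioo, integral_Ioc_eq_integral_Ioo]
  refine setIntegral_congr_fun measurableSet_Ioo fun s hs => ?_
  have h1 : t - s ∈ Ioc 0 T := ⟨by linarith [hs.2], by linarith [hs.1, ht.2]⟩
  have h2 : s ∈ Ioc 0 T := ⟨hs.1, by linarith [hs.2, ht.2]⟩
  simp only [hk h1, hh h2]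

section Scaled

variable {α T a c t σ : ℝ} {k : ℝ → Y →L[ℝ] Z} {h : ℝ → Y}

lemma scaled_mem (ht : t ∈ Ioc 0 T) (hσ : σ ∈ Ioo (0 : ℝ) 1) :
    t * σ ∈ Ioc 0 T ∧ t * (1 - σ) ∈ Ioc 0 T := by
  obtain ⟨h0, h1⟩ := hσ
  have h2 : 0 < 1 - σ := by linarith
  refine ⟨⟨mul_pos ht.1 h0, ?_⟩, ⟨mul_pos ht.1 h2, ?_⟩⟩ <;> nlinarith [ht.1, ht.2]

lemma norm_scaled_le (hk : WeaklySingular α T a k) (hh : WeaklySingular α T c h)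
    (ht : t ∈ Ioc 0 T) (hσ : σ ∈ Ioo (0 : ℝ) 1) :
    ‖k (t * (1 - σ)) (h (t * σ))‖ ≤
      a * c * (t ^ (α - 1) * t ^ (α - 1)) * ((1 - σ) ^ (α - 1) * σ ^ (α - 1)) := by
  obtain ⟨h1, h2⟩ := scaled_mem ht hσ
  have ha := hk.const_nonneg (ht.1.trans_le ht.2)
  calc _ ≤ ‖k (t * (1 - σ))‖ * ‖h (t * σ)‖ := (k _).le_opNorm _
    _ ≤ (a * (t * (1 - σ)) ^ (α - 1)) * (c * (t * σ) ^ (α - 1)) :=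
        mul_le_mul (hk.bound _ h2) (hh.bound _ h1) (norm_nonneg _)
          (mul_nonneg ha (Real.rpow_nonneg h2.1.le _))
    _ = _ := by
        rw [Real.mul_rpow ht.1.le (by linarith [hσ.2]), Real.mul_rpow ht.1.le hσ.1.le]
        ring

lemma continuousOn_scaled (hk : ContinuousOn k (Ioc 0 T)) (hh : ContinuousOn h (Ioc 0 T))
    (ht : t ∈ Ioc 0 T) :
    ContinuousOn (fun σ => k (t * (1 - σ)) (h (t * σ))) (Ioo (0 : ℝ) 1) :=
  (hk.comp (by fun_prop) fun _ hσ => (scaled_mem ht hσ).2).clm_apply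
    (hh.comp (by fun_prop) fun _ hσ => (scaled_mem ht hσ).1)

lemma ae_mem_uIoc_imp {P : ℝ → Prop} (hP : ∀ σ ∈ Ioo (0 : ℝ) 1, P σ) :
    ∀ᵐ σ : ℝ, σ ∈ uIoc (0 : ℝ) 1 → P σ := by
  have : ∀ᵐ σ : ℝ, σ ≠ 1 := by simp [ae_iff]
  filter_upwards [this] with σ h1 h2
  rw [uIoc_of_le zero_le_one] at h2
  exact hP σ ⟨h2.1, lt_of_le_of_ne h2.2 h1⟩

lemma rpow_sub_one_le_of_half {t₀ : ℝ} (hα : α ≤ 1) (h0 : 0 < t₀) (ht : t₀ / 2 < t) :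
    t ^ (α - 1) ≤ (t₀ / 2) ^ (α - 1) :=
  Real.rpow_le_rpow_of_nonpos (by linarith) ht.le (by linarith)

lemma intervalIntegrable_scaled (hα0 : 0 < α) (hα1 : α ≤ 1) (hk : WeaklySingular α T a k)
    (hh : WeaklySingular α T c h) (ht : t ∈ Ioc 0 T) :
    IntervalIntegrable (fun σ => k (t * (1 - σ)) (h (t * σ))) volume 0 1 := by
  refine ((intervalIntegrable_beta hα0 hα1 hα0 hα1).const_mul
    (a * c * (t ^ (α - 1) * t ^ (α - 1)))).mono_fun ?_ ?_
  · rw [uIoc_of_le zero_le_one]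
    exact aestronglyMeasurable_Ioc_of_Ioo (continuousOn_scaled hk.cont hh.cont ht)
  · refine (ae_restrict_iff' measurableSet_uIoc).2 (ae_mem_uIoc_imp fun σ hσ => ?_)
    exact (norm_scaled_le hk hh ht hσ).trans (le_abs_self _)

lemma intervalIntegrable_conv (hα0 : 0 < α) (hα1 : α ≤ 1) (hk : WeaklySingular α T a k)
    (hh : WeaklySingular α T c h) (ht : t ∈ Ioc 0 T) :
    IntervalIntegrable (fun s => k (t - s) (h s)) volume 0 t := by
  have := (intervalIntegrable_scaled hα0 hα1 hk hh ht).comp_mul_left (c := t⁻¹)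
  simp only [zero_div, one_div, inv_inv] at this
  refine this.congr (fun s _ => ?_)
  have h0 : t ≠ 0 := ht.1.ne'
  congr 2
  · field_simp
  · field_simp

/-- The continuity of scaled integrals with a weakly singular bound. -/
lemma continuousOn_integral_scaled {F : ℝ → ℝ → Z} {β : ℝ → ℝ} {D : ℝ} (hα1 : α ≤ 1)
    (hD : 0 ≤ D) (hβ : IntervalIntegrable β volume 0 1) (hβ0 : ∀ σ ∈ Ioo (0 : ℝ) 1, 0 ≤ β σ)
    (hF : ∀ t ∈ Ioc 0 T, ContinuousOn (F t) (Ioo 0 1))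
    (hF' : ∀ σ ∈ Ioo (0 : ℝ) 1, ContinuousOn (fun t => F t σ) (Ioc 0 T))
    (hb : ∀ t ∈ Ioc 0 T, ∀ σ ∈ Ioo (0 : ℝ) 1,
      ‖F t σ‖ ≤ D * (t ^ (α - 1) * t ^ (α - 1)) * β σ) :
    ContinuousOn (fun t => ∫ σ in (0 : ℝ)..1, F t σ) (Ioc 0 T) := by
  intro t₀ ht₀
  -- Staying above `t₀ / 2` bounds the powers of `t` uniformly and so gives a majorant independent
  -- of `t`.
  have hev : ∀ᶠ t in nhdsWithin t₀ (Ioc 0 T), t ∈ Ioc 0 T ∧ t₀ / 2 < t := by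
    filter_upwards [self_mem_nhdsWithin,
      mem_nhdsWithin_of_mem_nhds (Ioi_mem_nhds (show t₀ / 2 < t₀ by linarith [ht₀.1]))]
      with t h1 h2 using ⟨h1, h2⟩
  refine intervalIntegral.continuousWithinAt_of_dominated_interval
    (bound := fun σ => D * ((t₀ / 2) ^ (α - 1) * (t₀ / 2) ^ (α - 1)) * β σ) ?_ ?_
    (hβ.const_mul _) ?_
  · filter_upwards [hev] with t ht
    rw [uIoc_of_le zero_le_one]
    exact aestronglyMeasurable_Ioc_of_Ioo (hF t ht.1)
  · filter_upwards [hev] with t ht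
    refine ae_mem_uIoc_imp fun σ hσ => (hb t ht.1 σ hσ).trans ?_
    have h1 := rpow_sub_one_le_of_half hα1 ht₀.1 ht.2
    have h2 := Real.rpow_nonneg ht.1.1.le (α - 1)
    exact mul_le_mul_of_nonneg_right (mul_le_mul_of_nonneg_left
      (mul_le_mul h1 h1 h2 (h2.trans h1)) hD) (hβ0 σ hσ)
  · exact ae_mem_uIoc_imp fun σ hσ => hF' σ hσ t₀ ht₀

lemma beta_integrand_nonneg (p q : ℝ) (hσ : σ ∈ Ioo (0 : ℝ) 1) :
    0 ≤ (1 - σ) ^ (p - 1) * σ ^ (q - 1) :=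
  mul_nonneg (Real.rpow_nonneg (sub_nonneg.2 hσ.2.le) _) (Real.rpow_nonneg hσ.1.le _)

lemma mul_rpow_sub_one (ht : 0 < t) (α : ℝ) : t * t ^ (α - 1) = t ^ α := by
  conv_lhs => rw [← Real.rpow_one t, Real.rpow_one, mul_comm]
  rw [← Real.rpow_add_one ht.ne']; simp

/-- Scaling produces `t · t^{α-1} · t^{α-1}` times a beta integral; the factor `t · t^{α-1} = t^α`
is absorbed into `T^α`. -/
lemma WeaklySingular.conv (hα0 : 0 < α) (hα1 : α ≤ 1) (hT : 0 < T) (hk : WeaklySingular α T a k)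
    (hh : WeaklySingular α T c h) :
    WeaklySingular α T (a * c * T ^ α * betaInt α α) (conv k h) := by
  have ha := hk.const_nonneg hT
  have hc := hh.const_nonneg hT
  constructor
  · have : ContinuousOn (fun t : ℝ => t • ∫ σ in (0 : ℝ)..1, k (t * (1 - σ)) (h (t * σ)))
        (Ioc 0 T) := by
      refine continuousOn_id.smul (continuousOn_integral_scaled hα1 (mul_nonneg ha hc)
        (intervalIntegrable_beta hα0 hα1 hα0 hα1) (fun σ hσ => beta_integrand_nonneg _ _ hσ)
        (fun t ht => continuousOn_scaled hk.cont hh.cont ht) (fun σ hσ => ?_)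
        fun t ht σ hσ => norm_scaled_le hk hh ht hσ)
      exact (hk.cont.comp (by fun_prop) fun t ht => (scaled_mem ht hσ).2).clm_apply
        (hh.cont.comp (by fun_prop) fun t ht => (scaled_mem ht hσ).1)
    exact this.congr fun t _ => conv_eq_scaled k h t
  · intro t ht
    rw [conv_eq_scaled, norm_smul, Real.norm_of_nonneg ht.1.le]
    have h1 := intervalIntegral.norm_integral_le_of_norm_le zero_le_one
      (f := fun σ => k (t * (1 - σ)) (h (t * σ)))
      (by simpa only [uIoc_of_le zero_le_one] using
        ae_mem_uIoc_imp fun σ hσ => norm_scaled_le hk hh ht hσ)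
      ((intervalIntegrable_beta hα0 hα1 hα0 hα1).const_mul _)
    rw [intervalIntegral.integral_const_mul] at h1
    have h2 : t ^ α ≤ T ^ α := Real.rpow_le_rpow ht.1.le ht.2 hα0.le
    calc _ ≤ t * (a * c * (t ^ (α - 1) * t ^ (α - 1)) * betaInt α α) :=
          mul_le_mul_of_nonneg_left h1 ht.1.le
      _ = a * c * t ^ α * betaInt α α * t ^ (α - 1) := by
          rw [← mul_rpow_sub_one ht.1 α]; ring
      _ ≤ _ := by
          have := betaInt_nonneg α α
          have := Real.rpow_nonneg ht.1.le (α - 1)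
          gcongr

end Scaled

/-! ### Fubini's theorem for convolutions, and primitives of weakly singular functions. -/

section Fubini

variable {X : Type*} [NormedAddCommGroup X] [NormedSpace ℝ X]

/-- Fubini on the triangle `0 < s < r < t`. -/
lemma integral_triangle_swap (L : X →L[ℝ] Y →L[ℝ] Z) {f : ℝ → X} {g : ℝ → Y} {t : ℝ} (ht : 0 ≤ t)
    [CompleteSpace Y] [CompleteSpace Z]
    (hf : IntervalIntegrable f volume 0 t) (hg : IntervalIntegrable g volume 0 t) :
    ∫ r in (0 : ℝ)..t, ∫ s in (0 : ℝ)..r, L (f s) (g (r - s)) =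
      ∫ s in (0 : ℝ)..t, L (f s) (∫ r in (0 : ℝ)..(t - s), g r) := by
  -- Cutting both functions off to `(0, t)` turns the triangle integral into a convolution on the
  -- line, whose integrand is integrable on the product space.
  set f' := indicator (Ioo 0 t) f with hf'
  set g' := indicator (Ioo 0 t) g with hg'
  have hfi : Integrable f' := (integrable_indicator_iff measurableSet_Ioo).2
    (((intervalIntegrable_iff_integrableOn_Ioo_of_le ht).1 hf))
  have hgi : Integrable g' := (integrable_indicator_iff measurableSet_Ioo).2
    (((intervalIntegrable_iff_integrableOn_Ioo_of_le ht).1 hg))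
  have hint := hfi.convolution_integrand L hgi
  have hint' : Integrable (Function.uncurry fun r s => L (f' s) (g' (r - s)))
      ((volume.restrict (Ioc 0 t)).prod volume) :=
    hint.mono_measure (Measure.prod_mono Measure.restrict_le_self le_rfl)
  have hswap := integral_integral_swap hint'
  have hl : ∀ r ∈ Ioc 0 t, ∫ s, L (f' s) (g' (r - s)) =
      ∫ s in (0 : ℝ)..r, L (f s) (g (r - s)) := by
    intro r hr
    rw [intervalIntegral.integral_of_le hr.1.le, integral_Ioc_eq_integral_Ioo,
      ← integral_indicator measurableSet_Ioo]
    congr 1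
    ext s
    by_cases hs : s ∈ Ioo 0 r
    · rw [indicator_of_mem hs, hf', hg', indicator_of_mem, indicator_of_mem]
      · exact ⟨by linarith [hs.2], by linarith [hs.1, hr.2]⟩
      · exact ⟨hs.1, by linarith [hs.2, hr.2]⟩
    · rw [indicator_of_notMem hs]
      by_cases h1 : s ∈ Ioo 0 t
      · have : r - s ∉ Ioo 0 t := fun h => hs ⟨h1.1, by linarith [h.1]⟩
        simp [hg', indicator_of_notMem this]
      · simp [hf', indicator_of_notMem h1]
  have hr : ∀ s, ∫ r in Ioc 0 t, L (f' s) (g' (r - s)) =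
      indicator (Ioo 0 t) (fun s => L (f s) (∫ r in (0 : ℝ)..(t - s), g r)) s := by
    intro s
    by_cases hs : s ∈ Ioo 0 t
    · rw [indicator_of_mem hs, hf', indicator_of_mem hs]
      rw [(L (f s)).integral_comp_comm (hgi.comp_sub_right s).integrableOn]
      congr 1
      rw [← intervalIntegral.integral_of_le ht, intervalIntegral.integral_comp_sub_right,
        ← intervalIntegral.integral_add_adjacent_intervals (b := 0)
          hgi.intervalIntegrable hgi.intervalIntegrable]
      have h0 : ∫ x in (0 - s)..0, g' x = 0 := by
        rw [intervalIntegral.integral_of_le (by linarith [hs.1])]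
        refine setIntegral_eq_zero_of_forall_eq_zero fun x hx => ?_
        exact indicator_of_notMem (fun h => absurd h.1 (not_lt.2 hx.2)) _
      rw [h0, zero_add, intervalIntegral.integral_of_le (by linarith [hs.2]),
        intervalIntegral.integral_of_le (by linarith [hs.2])]
      refine setIntegral_congr_fun measurableSet_Ioc fun x hx => ?_
      exact indicator_of_mem (show x ∈ Ioo 0 t from ⟨hx.1, by linarith [hx.2, hs.1]⟩) _
    · rw [indicator_of_notMem hs, hf', indicator_of_notMem hs]
      simp
  rw [intervalIntegral.integral_of_le ht, ← setIntegral_congr_fun measurableSet_Ioc hl, hswap]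
  simp_rw [hr]
  rw [integral_indicator measurableSet_Ioo, intervalIntegral.integral_of_le ht,
    integral_Ioc_eq_integral_Ioo]

lemma conv_eq_comp_sub (k : ℝ → Y →L[ℝ] Z) (h : ℝ → Y) (t : ℝ) :
    conv k h t = ∫ s in (0 : ℝ)..t, k s (h (t - s)) := by
  have := intervalIntegral.integral_comp_sub_left (a := 0) (b := t)
    (fun s => k (t - s) (h s)) t
  simp only [sub_sub_cancel, sub_self, sub_zero] at this
  exact this.symm

variable {k : ℝ → Y →L[ℝ] Z} {h : ℝ → Y} {t : ℝ} [CompleteSpace Y] [CompleteSpace Z]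

lemma integral_conv_left (ht : 0 ≤ t) (hk : IntervalIntegrable k volume 0 t)
    (hh : IntervalIntegrable h volume 0 t) :
    ∫ r in (0 : ℝ)..t, conv k h r = conv (fun s => ∫ r in (0 : ℝ)..s, k r) h t :=
  integral_triangle_swap (ContinuousLinearMap.id ℝ (Y →L[ℝ] Z)).flip ht hh hk

lemma integral_conv_right (ht : 0 ≤ t) (hk : IntervalIntegrable k volume 0 t)
    (hh : IntervalIntegrable h volume 0 t) :
    ∫ r in (0 : ℝ)..t, conv k h r = conv k (fun s => ∫ r in (0 : ℝ)..s, h r) t := by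
  have := integral_triangle_swap (ContinuousLinearMap.id ℝ (Y →L[ℝ] Z)) ht hk hh
  simpa only [conv_eq_comp_sub, ContinuousLinearMap.id_apply] using this

end Fubini

section Primitive

variable {α T c : ℝ} {h : ℝ → Y} [CompleteSpace Y]

lemma WeaklySingular.hasDerivWithinAt_integral (hh : WeaklySingular α T c h) (hα : 0 < α) {t : ℝ}
    (ht : t ∈ Ioc 0 T) :
    HasDerivWithinAt (fun s => ∫ r in (0 : ℝ)..s, h r) (h t) (Ioc 0 T) t := by
  have hT : 0 < T := ht.1.trans_le ht.2
  -- Constant continuation beyond `T` makes the two-sided fundamental theorem available at `t = T`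
  -- as well.
  set h' : ℝ → Y := fun s => h (min s T) with hh'
  have hc : ContinuousOn h' (Ioi 0) :=
    hh.cont.comp (by fun_prop) fun s hs => ⟨lt_min hs hT, min_le_right _ _⟩
  have heq : ∀ s ∈ Ioc 0 T, h' s = h s := fun s hs => by simp [hh', min_eq_left hs.2]
  have hint : ∀ s ∈ Ioc 0 T, ∫ r in (0 : ℝ)..s, h r = ∫ r in (0 : ℝ)..s, h' r := by
    intro s hs
    refine intervalIntegral.integral_congr_ae (ae_of_all _ fun r hr => ?_)
    rw [uIoc_of_le hs.1.le] at hr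
    exact (heq r ⟨hr.1, hr.2.trans hs.2⟩).symm
  have hi : IntervalIntegrable h' volume 0 t := by
    refine (hh.intervalIntegrable hα ht.1.le ht.2).congr fun r hr => ?_
    rw [uIoc_of_le ht.1.le] at hr
    exact (heq r ⟨hr.1, hr.2.trans ht.2⟩).symm
  have hd := intervalIntegral.integral_hasDerivAt_right hi
    (hc.stronglyMeasurableAtFilter isOpen_Ioi t ht.1) (hc.continuousAt (Ioi_mem_nhds ht.1))
  rw [heq t ht] at hd
  exact hd.hasDerivWithinAt.congr hint (hint t ht)

lemma WeaklySingular.continuousOn_integral (hh : WeaklySingular α T c h) (hα : 0 < α)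
    (hT : 0 ≤ T) : ContinuousOn (fun s => ∫ r in (0 : ℝ)..s, h r) (Icc 0 T) := by
  have := intervalIntegral.continuousOn_primitive_interval (μ := volume) (f := h) (a := 0) (b := T)
    (by rw [uIcc_of_le hT, integrableOn_Icc_iff_integrableOn_Ioc,
        ← intervalIntegrable_iff_integrableOn_Ioc_of_le hT]
        exact hh.intervalIntegrable hα hT le_rfl)
  rwa [uIcc_of_le hT] at this

end Primitive

lemma derivWithin_Ioc {T t : ℝ} {f : ℝ → Y} {f' : Y} (ht : t ∈ Ioc 0 T)
    (h : HasDerivWithinAt f f' (Ioc 0 T) t) : derivWithin f (Ioc 0 T) t = f' :=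
  h.derivWithin (uniqueDiffOn_Ioc 0 T t ht)

end TemperedVolterra

/-! ### Smoothing families and the function `A (E * φ)`. -/

namespace TemperedVolterra

/-- The properties of `K = A⁻¹`, `E(t) = exp(-tA)` and `G(t) = A exp(-tA)` that are used. -/
structure SmoothingFamily {Y : Type*} [NormedAddCommGroup Y] [NormedSpace ℝ Y]
    (K : Y →L[ℝ] Y) (E G : ℝ → Y →L[ℝ] Y) : Prop where
  cont_E : ContinuousOn E (Ioi 0)
  cont_G : ContinuousOn G (Ioi 0)
  norm_E : ∀ t, 0 < t → ‖E t‖ ≤ 1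
  norm_G : ∀ t, 0 < t → ‖G t‖ ≤ t⁻¹
  apply_G : ∀ t, 0 < t → ∀ y, K (G t y) = E t y
  comm : ∀ t, 0 < t → ∀ y, K (E t y) = E t (K y)
  integral_E : ∀ t, 0 < t → ∀ y, ∫ s in (0 : ℝ)..t, E s y = K (y - E t y)
  injective : ∀ y, K y = 0 → y = 0

/-- Functions on `(0, T]` that are bounded by `c t^{α-1}` and have the Lipschitz constant
`c s^{α-2}` on `[s, T]`. -/
structure LipschitzSingular {Y : Type*} [NormedAddCommGroup Y] (α T c : ℝ) (φ : ℝ → Y) : Prop where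
  bound : ∀ t ∈ Ioc 0 T, ‖φ t‖ ≤ c * t ^ (α - 1)
  lipschitz : ∀ s t, 0 < s → s ≤ t → t ≤ T → ‖φ t - φ s‖ ≤ c * s ^ (α - 2) * (t - s)

/-- The function `A (E * φ)`. -/
noncomputable def smoothed {Y : Type*} [NormedAddCommGroup Y] [NormedSpace ℝ Y]
    (E G : ℝ → Y →L[ℝ] Y) (φ : ℝ → Y) (t : ℝ) : Y :=
  φ t - E t (φ t) + ∫ σ in (0 : ℝ)..1, t • G (t * (1 - σ)) (φ (t * σ) - φ t)

variable {Y Z : Type*} [NormedAddCommGroup Y] [NormedSpace ℝ Y]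
  [NormedAddCommGroup Z] [NormedSpace ℝ Z]

namespace LipschitzSingular

variable {α T c : ℝ} {φ : ℝ → Y}

lemma weaklySingular (h : LipschitzSingular α T c φ) (hα : α ≤ 1) : WeaklySingular α T c φ := by
  refine ⟨fun t₀ ht₀ => ?_, h.bound⟩
  have hT : 0 < T := ht₀.1.trans_le ht₀.2
  have h0 : 0 < t₀ / 2 := half_pos ht₀.1
  have hc : 0 ≤ c := nonneg_of_mul_nonneg_left
    ((norm_nonneg _).trans (h.bound T ⟨hT, le_rfl⟩)) (Real.rpow_pos_of_pos hT _)
  have hp : 0 ≤ c * (t₀ / 2) ^ (α - 2) := mul_nonneg hc (Real.rpow_nonneg h0.le _)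
  have key : ∀ s t, t₀ / 2 ≤ s → s ≤ t → t ≤ T →
      ‖φ t - φ s‖ ≤ c * (t₀ / 2) ^ (α - 2) * (t - s) := fun s t h1 h2 h3 =>
    (h.lipschitz s t (h0.trans_le h1) h2 h3).trans (mul_le_mul_of_nonneg_right
      (mul_le_mul_of_nonneg_left (Real.rpow_le_rpow_of_nonpos h0 h1 (by linarith)) hc)
      (by linarith))
  have hlip : LipschitzOnWith (c * (t₀ / 2) ^ (α - 2)).toNNReal φ (Icc (t₀ / 2) T) := by
    refine LipschitzOnWith.of_dist_le_mul fun x hx y hy => ?_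
    rw [Real.coe_toNNReal _ hp, dist_eq_norm, Real.dist_eq]
    rcases le_total x y with hxy | hxy
    · rw [norm_sub_rev, abs_sub_comm, abs_of_nonneg (sub_nonneg.2 hxy)]
      exact key x y hx.1 hxy hy.2
    · rw [abs_of_nonneg (sub_nonneg.2 hxy)]
      exact key y x hy.1 hxy hx.2
  have hmem : Icc (t₀ / 2) T ∈ nhdsWithin t₀ (Ioc 0 T) := by
    filter_upwards [self_mem_nhdsWithin,
      mem_nhdsWithin_of_mem_nhds (Ioi_mem_nhds (show t₀ / 2 < t₀ by linarith [ht₀.1]))]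
      with t h1 h2 using ⟨(mem_Ioi.1 h2).le, h1.2⟩
  exact (hlip.continuousOn t₀ ⟨by linarith [ht₀.1], ht₀.2⟩).mono_of_mem_nhdsWithin hmem

lemma sub {c' : ℝ} {ψ : ℝ → Y} (h : LipschitzSingular α T c φ) (h' : LipschitzSingular α T c' ψ) :
    LipschitzSingular α T (c + c') (fun t => φ t - ψ t) where
  bound t ht := (norm_sub_le _ _).trans
    ((add_le_add (h.bound t ht) (h'.bound t ht)).trans_eq (add_mul _ _ _).symm)
  lipschitz s t h0 h1 h2 := by
    rw [sub_sub_sub_comm, add_mul, add_mul]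
    exact (norm_sub_le _ _).trans (add_le_add (h.lipschitz s t h0 h1 h2) (h'.lipschitz s t h0 h1 h2))

lemma sum {ι : Type*} {s : Finset ι} {c : ι → ℝ} {φ : ι → ℝ → Y}
    (h : ∀ i ∈ s, LipschitzSingular α T (c i) (φ i)) :
    LipschitzSingular α T (∑ i ∈ s, c i) (fun t => ∑ i ∈ s, φ i t) where
  bound t ht := by
    rw [Finset.sum_mul]
    exact norm_sum_le_of_le _ fun i hi => (h i hi).bound t ht
  lipschitz r t h0 h1 h2 := by
    rw [← Finset.sum_sub_distrib, Finset.sum_mul, Finset.sum_mul]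
    exact norm_sum_le_of_le _ fun i hi => (h i hi).lipschitz r t h0 h1 h2

lemma clm_apply (h : LipschitzSingular α T c φ) (L : Y →L[ℝ] Z) :
    LipschitzSingular α T (‖L‖ * c) (fun t => L (φ t)) where
  bound t ht := (L.le_opNorm _).trans (by
    rw [mul_assoc]; exact mul_le_mul_of_nonneg_left (h.bound t ht) (norm_nonneg _))
  lipschitz s t h0 h1 h2 := by
    rw [← map_sub, mul_assoc, mul_assoc]
    exact (L.le_opNorm _).trans (mul_le_mul_of_nonneg_left
      ((h.lipschitz s t h0 h1 h2).trans_eq (mul_assoc _ _ _)) (norm_nonneg _))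

lemma mono_const {c' : ℝ} (h : LipschitzSingular α T c φ) (hc : c ≤ c') :
    LipschitzSingular α T c' φ where
  bound t ht := (h.bound t ht).trans
    (mul_le_mul_of_nonneg_right hc (Real.rpow_nonneg ht.1.le _))
  lipschitz s t h0 h1 h2 := (h.lipschitz s t h0 h1 h2).trans
    (mul_le_mul_of_nonneg_right (mul_le_mul_of_nonneg_right hc (Real.rpow_nonneg h0.le _))
      (by linarith))

lemma of_deriv {φ' : ℝ → Y} (hα : α ≤ 2) (hc : 0 ≤ c)
    (hb : ∀ t ∈ Ioc 0 T, ‖φ t‖ ≤ c * t ^ (α - 1))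
    (hd : ∀ t ∈ Ioc 0 T, HasDerivWithinAt φ (φ' t) (Ioc 0 T) t)
    (hb' : ∀ t ∈ Ioc 0 T, ‖φ' t‖ ≤ c * t ^ (α - 2)) : LipschitzSingular α T c φ where
  bound := hb
  lipschitz s t h0 h1 h2 := by
    have hsub : Icc s t ⊆ Ioc 0 T := fun x hx => ⟨h0.trans_le hx.1, hx.2.trans h2⟩
    have := Convex.norm_image_sub_le_of_norm_hasDerivWithin_le (s := Icc s t) (f := φ) (f' := φ')
      (C := c * s ^ (α - 2)) (x := s) (y := t)
      (fun x hx => (hd x (hsub hx)).mono hsub)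
      (fun x hx => (hb' x (hsub hx)).trans (mul_le_mul_of_nonneg_left
        (Real.rpow_le_rpow_of_nonpos h0 hx.1 (by linarith)) hc))
      (convex_Icc s t) ⟨le_rfl, h1⟩ ⟨h1, le_rfl⟩
    rwa [Real.norm_of_nonneg (sub_nonneg.2 h1)] at this

end LipschitzSingular

namespace SmoothingFamily

variable {K : Y →L[ℝ] Y} {E G : ℝ → Y →L[ℝ] Y} {α T c t : ℝ} {φ h : ℝ → Y}

/-- The family of left compositions. -/
lemma compL [CompleteSpace Y] (S : SmoothingFamily K E G) :
    SmoothingFamily (ContinuousLinearMap.compL ℝ Y Y Y K)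
      (fun t => ContinuousLinearMap.compL ℝ Y Y Y (E t))
      (fun t => ContinuousLinearMap.compL ℝ Y Y Y (G t)) where
  cont_E := (ContinuousLinearMap.compL ℝ Y Y Y).continuous.comp_continuousOn S.cont_E
  cont_G := (ContinuousLinearMap.compL ℝ Y Y Y).continuous.comp_continuousOn S.cont_G
  norm_E t ht := ((ContinuousLinearMap.compL ℝ Y Y Y).le_opNorm _).trans
    ((mul_le_of_le_one_left (norm_nonneg _) (ContinuousLinearMap.norm_compL_le ℝ Y Y Y)).trans
      (S.norm_E t ht))
  norm_G t ht := ((ContinuousLinearMap.compL ℝ Y Y Y).le_opNorm _).trans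
    ((mul_le_of_le_one_left (norm_nonneg _) (ContinuousLinearMap.norm_compL_le ℝ Y Y Y)).trans
      (S.norm_G t ht))
  apply_G t ht y := by ext x; simpa using S.apply_G t ht (y x)
  comm t ht y := by ext x; simpa using S.comm t ht (y x)
  integral_E t ht y := by
    have hE : IntervalIntegrable E volume 0 t :=
      (WeaklySingular.of_bounded le_rfl (S.cont_E.mono fun x (hx : x ∈ Ioc 0 t) => hx.1) zero_le_one
        fun s hs => S.norm_E s hs.1).intervalIntegrable one_pos ht.le le_rfl
    have hE' : IntervalIntegrable (fun s => ContinuousLinearMap.compL ℝ Y Y Y (E s) y) volume 0 t :=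
      ⟨((ContinuousLinearMap.compL ℝ Y Y Y).flip y).integrable_comp hE.1,
        ((ContinuousLinearMap.compL ℝ Y Y Y).flip y).integrable_comp hE.2⟩
    ext x
    rw [ContinuousLinearMap.intervalIntegral_apply hE']
    simpa using S.integral_E t ht (y x)
  injective y hy := by
    ext x
    exact S.injective _ (by simpa using congrArg (fun L => L x) hy)

lemma weaklySingular_E (S : SmoothingFamily K E G) (hα : α ≤ 1) :
    WeaklySingular α T (1 * T ^ (1 - α)) E :=
  .of_bounded hα (S.cont_E.mono fun _ hx => hx.1) zero_le_one fun s hs => S.norm_E s hs.1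

/-- The bound for `t G(t(1-σ))` is `(1-σ)⁻¹`. For `σ ≥ 1/2` the Lipschitz estimate contributes a
factor `t(1-σ)` that cancels it; for `σ ≤ 1/2` it is at most `2` and the size of `φ` suffices. Only
the integrable `σ^{α-1}` survives. -/
lemma norm_smoothed_integrand_le (S : SmoothingFamily K E G) (hα1 : α ≤ 1)
    (hφ : LipschitzSingular α T c φ) (ht : t ∈ Ioc 0 T) {σ : ℝ} (hσ : σ ∈ Ioo (0 : ℝ) 1) :
    ‖t • G (t * (1 - σ)) (φ (t * σ) - φ t)‖ ≤ 4 * c * t ^ (α - 1) * σ ^ (α - 1) := by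
  obtain ⟨h1, h2⟩ := scaled_mem ht hσ
  have hc := (hφ.weaklySingular hα1).const_nonneg (ht.1.trans_le ht.2)
  have h3 : 0 < 1 - σ := by linarith [hσ.2]
  have hG : ‖t • G (t * (1 - σ)) (φ (t * σ) - φ t)‖ ≤
      (1 - σ)⁻¹ * ‖φ (t * σ) - φ t‖ := by
    rw [norm_smul, Real.norm_of_nonneg ht.1.le]
    calc _ ≤ t * ((t * (1 - σ))⁻¹ * ‖φ (t * σ) - φ t‖) := by
          refine mul_le_mul_of_nonneg_left (((G _).le_opNorm _).trans ?_) ht.1.le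
          exact mul_le_mul_of_nonneg_right (S.norm_G _ h2.1) (norm_nonneg _)
      _ = _ := by
          have := ht.1.ne'
          field_simp
  refine hG.trans ?_
  have p1 : 0 ≤ t ^ (α - 1) := Real.rpow_nonneg ht.1.le _
  have p2 : 0 ≤ σ ^ (α - 1) := Real.rpow_nonneg hσ.1.le _
  rcases le_total (1 / 2) σ with h4 | h4
  · have h5 := hφ.lipschitz (t * σ) t h1.1 (by nlinarith [ht.1, hσ.2]) ht.2
    rw [norm_sub_rev] at h5
    have e1 : (t * σ) ^ (α - 2) * (t * σ) = t ^ (α - 1) * σ ^ (α - 1) := by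
      rw [← Real.mul_rpow ht.1.le hσ.1.le, ← Real.rpow_add_one h1.1.ne']
      ring_nf
    have e2 : 0 ≤ (t * σ) ^ (α - 2) := Real.rpow_nonneg h1.1.le _
    calc _ ≤ (1 - σ)⁻¹ * (c * (t * σ) ^ (α - 2) * (t - t * σ)) := by gcongr
      _ = c * ((t * σ) ^ (α - 2) * t) := by field_simp
      _ ≤ c * (2 * ((t * σ) ^ (α - 2) * (t * σ))) := by
          refine mul_le_mul_of_nonneg_left ?_ hc
          nlinarith [mul_nonneg e2 ht.1.le]
      _ = 2 * c * t ^ (α - 1) * σ ^ (α - 1) := by rw [e1]; ring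
      _ ≤ _ := by nlinarith [mul_nonneg (mul_nonneg hc p1) p2]
  · have h5 : ‖φ (t * σ) - φ t‖ ≤ 2 * (c * t ^ (α - 1) * σ ^ (α - 1)) := by
      refine (norm_sub_le _ _).trans ?_
      have a1 := hφ.bound _ h1
      rw [Real.mul_rpow ht.1.le hσ.1.le] at a1
      have a2 := hφ.bound _ ht
      have a3 : 1 ≤ σ ^ (α - 1) :=
        Real.one_le_rpow_of_pos_of_le_one_of_nonpos hσ.1 hσ.2.le (by linarith)
      nlinarith [mul_nonneg hc p1]
    have h6 : (1 - σ)⁻¹ ≤ 2 := by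
      rw [inv_le_comm₀ h3 two_pos]; linarith
    calc _ ≤ 2 * (2 * (c * t ^ (α - 1) * σ ^ (α - 1))) := by gcongr
      _ = _ := by ring

lemma continuousOn_smoothed_integrand (S : SmoothingFamily K E G) (hα1 : α ≤ 1)
    (hφ : LipschitzSingular α T c φ) (ht : t ∈ Ioc 0 T) :
    ContinuousOn (fun σ => t • G (t * (1 - σ)) (φ (t * σ) - φ t)) (Ioo (0 : ℝ) 1) := by
  refine ContinuousOn.const_smul ?_ _
  refine (S.cont_G.comp (by fun_prop) fun σ hσ => (scaled_mem ht hσ).2.1).clm_apply ?_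
  exact ((hφ.weaklySingular hα1).cont.comp (by fun_prop) fun σ hσ => (scaled_mem ht hσ).1).sub
    continuousOn_const

lemma intervalIntegrable_smoothed (S : SmoothingFamily K E G) (hα0 : 0 < α) (hα1 : α ≤ 1)
    (hφ : LipschitzSingular α T c φ) (ht : t ∈ Ioc 0 T) :
    IntervalIntegrable (fun σ => t • G (t * (1 - σ)) (φ (t * σ) - φ t)) volume 0 1 := by
  refine ((intervalIntegrable_rpow_sub_one hα0 0 1).const_mul (4 * c * t ^ (α - 1))).mono_fun ?_ ?_
  · rw [uIoc_of_le zero_le_one]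
    exact aestronglyMeasurable_Ioc_of_Ioo (S.continuousOn_smoothed_integrand hα1 hφ ht)
  · refine (ae_restrict_iff' measurableSet_uIoc).2 (ae_mem_uIoc_imp fun σ hσ => ?_)
    exact (S.norm_smoothed_integrand_le hα1 hφ ht hσ).trans (le_abs_self _)

lemma weaklySingular_smoothed (S : SmoothingFamily K E G) (hα0 : 0 < α) (hα1 : α ≤ 1)
    (hφ : LipschitzSingular α T c φ) :
    WeaklySingular α T ((2 + 4 / α) * c) (smoothed E G φ) := by
  constructor
  · have hc := (hφ.weaklySingular hα1).cont
    refine (hc.sub ((S.cont_E.mono fun _ hx => hx.1).clm_apply hc)).add ?_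
    rcases le_or_gt T 0 with hT | hT
    · rw [Ioc_eq_empty (not_lt.2 hT)]; exact continuousOn_empty _
    have hc0 := (hφ.weaklySingular hα1).const_nonneg hT
    -- The continuity criterion expects two factors `t^{α-1}` while the integrand has one; `T^{1-α}`
    -- pays for the second, since `1 ≤ T^{1-α} t^{α-1}`.
    refine continuousOn_integral_scaled (D := 4 * c * T ^ (1 - α)) (β := fun σ => σ ^ (α - 1)) hα1
      (by positivity) (intervalIntegrable_rpow_sub_one hα0 0 1)
      (fun σ hσ => Real.rpow_nonneg hσ.1.le _)
      (fun t ht => S.continuousOn_smoothed_integrand hα1 hφ ht) (fun σ hσ => ?_) fun t ht σ hσ => ?_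
    · refine continuousOn_id.smul ((S.cont_G.comp (by fun_prop)
        fun t ht => (scaled_mem ht hσ).2.1).clm_apply ?_)
      exact (hc.comp (by fun_prop) fun t ht => (scaled_mem ht hσ).1).sub hc
    · refine (S.norm_smoothed_integrand_le hα1 hφ ht hσ).trans ?_
      refine mul_le_mul_of_nonneg_right ?_ (Real.rpow_nonneg hσ.1.le _)
      have h1 := WeaklySingular.one_le_rpow hα1 ht
      have h2 : 0 ≤ 4 * c * t ^ (α - 1) := by
        have := Real.rpow_nonneg ht.1.le (α - 1); positivity
      calc _ ≤ 4 * c * t ^ (α - 1) * (T ^ (1 - α) * t ^ (α - 1)) := le_mul_of_one_le_right h2 h1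
        _ = _ := by ring
  · intro t ht
    have h1 := intervalIntegral.norm_integral_le_of_norm_le zero_le_one
      (f := fun σ => t • G (t * (1 - σ)) (φ (t * σ) - φ t))
      (by simpa only [uIoc_of_le zero_le_one] using
        ae_mem_uIoc_imp fun σ hσ => S.norm_smoothed_integrand_le hα1 hφ ht hσ)
      ((intervalIntegrable_rpow_sub_one hα0 0 1).const_mul _)
    rw [intervalIntegral.integral_const_mul, integral_rpow (Or.inl (by linarith))] at h1
    simp only [sub_add_cancel, Real.one_rpow, Real.zero_rpow hα0.ne', sub_zero] at h1
    have h2 := hφ.bound t ht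
    have h3 : ‖E t (φ t)‖ ≤ c * t ^ (α - 1) :=
      ((E t).le_of_opNorm_le (S.norm_E t ht.1) _).trans (by rwa [one_mul])
    refine (norm_add_le _ _).trans ((add_le_add ((norm_sub_le _ _).trans (add_le_add h2 h3))
      h1).trans_eq ?_)
    ring

/-- Under `K` the family `G` becomes `E`, and `K (φ(t) - E(t) φ(t)) = ∫_0^t E(s) φ(t) ds` restores
the constant subtracted inside the integral. This justifies reading `smoothed` as `A (E * φ)`
without an unbounded operator. -/
lemma apply_smoothed [CompleteSpace Y] (S : SmoothingFamily K E G) (hα0 : 0 < α) (hα1 : α ≤ 1)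
    (hφ : LipschitzSingular α T c φ) (ht : t ∈ Ioc 0 T) :
    K (smoothed E G φ t) = conv E φ t := by
  have hconst : WeaklySingular α T (‖φ t‖ * T ^ (1 - α)) (fun _ : ℝ => φ t) :=
    .of_bounded hα1 continuousOn_const (norm_nonneg _) fun _ _ => le_rfl
  have hE := S.weaklySingular_E (T := T) hα1
  have h1 : ∫ s in (0 : ℝ)..t, E s (φ t) = t • ∫ σ in (0 : ℝ)..1, E (t * (1 - σ)) (φ t) := by
    rw [← conv_eq_scaled E (fun _ => φ t), conv_eq_comp_sub]
  rw [smoothed, map_add, ← ContinuousLinearMap.intervalIntegral_comp_comm _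
    (S.intervalIntegrable_smoothed hα0 hα1 hφ ht), ← S.integral_E t ht.1, h1, conv_eq_scaled,
    ← intervalIntegral.integral_smul, ← intervalIntegral.integral_smul,
    ← intervalIntegral.integral_add]
  · refine intervalIntegral.integral_congr_ae (ae_mem_uIoc_imp fun σ hσ => ?_)
    rw [map_smul, S.apply_G _ (scaled_mem ht hσ).2.1, map_sub, smul_sub]
    abel
  · exact (intervalIntegrable_scaled hα0 hα1 hE hconst ht).smul t
  · have := S.intervalIntegrable_smoothed hα0 hα1 hφ ht
    exact ⟨K.integrable_comp this.1, K.integrable_comp this.2⟩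

lemma conv_integral_E [CompleteSpace Y] (S : SmoothingFamily K E G) (hα0 : 0 < α) (hα1 : α ≤ 1)
    (hh : WeaklySingular α T c h) (ht : t ∈ Ioc 0 T) :
    conv (fun s => ∫ r in (0 : ℝ)..s, E r) h t = K ((∫ s in (0 : ℝ)..t, h s) - conv E h t) := by
  have hE := S.weaklySingular_E (T := T) hα1
  have hi := intervalIntegrable_conv hα0 hα1 hE hh ht
  have hi' := hh.intervalIntegrable hα0 ht.1.le ht.2
  rw [conv, conv, ← intervalIntegral.integral_sub hi' hi,
    ← ContinuousLinearMap.intervalIntegral_comp_comm _ (hi'.sub hi),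
    intervalIntegral.integral_of_le ht.1.le, intervalIntegral.integral_of_le ht.1.le,
    integral_Ioc_eq_integral_Ioo, integral_Ioc_eq_integral_Ioo]
  refine setIntegral_congr_fun measurableSet_Ioo fun s hs => ?_
  have h1 : 0 < t - s := by linarith [hs.2]
  rw [ContinuousLinearMap.intervalIntegral_apply
    (hE.intervalIntegrable hα0 h1.le (by linarith [hs.1, ht.2])), S.integral_E _ h1]

lemma integral_conv_E [CompleteSpace Y] (S : SmoothingFamily K E G) (hα0 : 0 < α) (hα1 : α ≤ 1)
    (hh : WeaklySingular α T c h) (ht : t ∈ Ioc 0 T) :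
    ∫ s in (0 : ℝ)..t, conv E h s = K ((∫ s in (0 : ℝ)..t, h s) - conv E h t) := by
  rw [integral_conv_left ht.1.le
    ((S.weaklySingular_E (T := T) hα1).intervalIntegrable hα0 ht.1.le ht.2)
    (hh.intervalIntegrable hα0 ht.1.le ht.2), S.conv_integral_E hα0 hα1 hh ht]

lemma integral_congr_Ioc {f g : ℝ → Y} (hfg : EqOn f g (Ioc 0 T)) (ht : t ∈ Ioc 0 T) :
    ∫ s in (0 : ℝ)..t, f s = ∫ s in (0 : ℝ)..t, g s := by
  rw [intervalIntegral.integral_of_le ht.1.le, intervalIntegral.integral_of_le ht.1.le]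
  exact setIntegral_congr_fun measurableSet_Ioc fun s hs => hfg ⟨hs.1, hs.2.trans ht.2⟩

/-- This is `w' + A w = φ`, `w(0) = 0` for `w = E * φ`, in integrated form. As `K` is injective, it
may be checked after applying `K`, where `integral_conv_E` and `apply_smoothed` give both sides. -/
lemma conv_E_eq_integral [CompleteSpace Y] (S : SmoothingFamily K E G) (hα0 : 0 < α) (hα1 : α ≤ 1)
    (hφ : LipschitzSingular α T c φ) (ht : t ∈ Ioc 0 T) :
    conv E φ t = ∫ s in (0 : ℝ)..t, (φ s - smoothed E G φ s) := by
  have hw := (hφ.weaklySingular hα1).intervalIntegrable hα0 ht.1.le ht.2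
  have hs := (S.weaklySingular_smoothed hα0 hα1 hφ).intervalIntegrable hα0 ht.1.le ht.2
  rw [intervalIntegral.integral_sub hw hs, eq_sub_iff_add_eq, ← eq_sub_iff_add_eq', ← sub_eq_zero]
  refine S.injective _ ?_
  rw [map_sub, ← S.integral_conv_E hα0 hα1 (hφ.weaklySingular hα1) ht,
    ← ContinuousLinearMap.intervalIntegral_comp_comm _ hs, sub_eq_zero]
  exact integral_congr_Ioc (fun s hs => S.apply_smoothed hα0 hα1 hφ hs) ht

/-- `E(t) y = y - ∫_0^t G(s) y ds` when the integrand is weakly singular. -/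
lemma E_eq_sub_integral [CompleteSpace Y] (S : SmoothingFamily K E G) (hα0 : 0 < α) {y : Y}
    (hy : WeaklySingular α T c (fun s => G s y)) (ht : t ∈ Ioc 0 T) :
    E t y = y - ∫ s in (0 : ℝ)..t, G s y := by
  rw [eq_sub_iff_add_eq, ← eq_sub_iff_add_eq', ← sub_eq_zero]
  refine S.injective _ ?_
  rw [map_sub, ← S.integral_E t ht.1, ← ContinuousLinearMap.intervalIntegral_comp_comm _
    (hy.intervalIntegrable hα0 ht.1.le ht.2), sub_eq_zero]
  exact integral_congr_Ioc (fun s hs => S.apply_G s hs.1 y) ht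

end SmoothingFamily

end TemperedVolterra

/-! ### Volterra equations of the second kind in exponentially weighted spaces. -/

namespace TemperedVolterra

variable {Y Z : Type*} [NormedAddCommGroup Y] [NormedSpace ℝ Y]
  [NormedAddCommGroup Z] [NormedSpace ℝ Z]

/-- The weight `t^{α-1} e^{λt}`. -/
noncomputable def weight (α lam t : ℝ) : ℝ := t ^ (α - 1) * Real.exp (lam * t)

variable {α T a c lam t : ℝ}

lemma weight_pos (ht : 0 < t) : 0 < weight α lam t :=
  mul_pos (Real.rpow_pos_of_pos ht _) (Real.exp_pos _)

lemma continuousOn_weight : ContinuousOn (weight α lam) (Ioc 0 T) := by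
  refine ContinuousOn.mul (fun x hx => ?_) (by fun_prop)
  exact (Real.continuousAt_rpow_const x _ (Or.inl hx.1.ne')).continuousWithinAt

lemma rpow_le_weight (hlam : 0 ≤ lam) (ht : 0 < t) : t ^ (α - 1) ≤ weight α lam t :=
  le_mul_of_one_le_right (Real.rpow_nonneg ht.le _)
    (Real.one_le_exp (mul_nonneg hlam ht.le))

lemma weight_le (hlam : 0 ≤ lam) (ht : t ∈ Ioc 0 T) :
    weight α lam t ≤ Real.exp (lam * T) * t ^ (α - 1) := by
  rw [weight, mul_comm]
  exact mul_le_mul_of_nonneg_right (Real.exp_le_exp.2 (mul_le_mul_of_nonneg_left ht.2 hlam))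
    (Real.rpow_nonneg ht.1.le _)

lemma exp_neg_le_rpow_neg {γ x : ℝ} (hγ0 : 0 ≤ γ) (hγ1 : γ ≤ 1) (hx : 0 < x) :
    Real.exp (-x) ≤ x ^ (-γ) := by
  rw [Real.exp_neg, Real.rpow_neg hx.le]
  refine inv_anti₀ (Real.rpow_pos_of_pos hx _) ?_
  rcases le_total x 1 with h | h
  · exact (Real.rpow_le_one hx.le h hγ0).trans (Real.one_le_exp hx.le)
  · calc x ^ γ ≤ x ^ (1 : ℝ) := Real.rpow_le_rpow_of_exponent_le h hγ1
      _ = x := Real.rpow_one x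
      _ ≤ Real.exp x := by linarith [Real.add_one_le_exp x]

/-- The norm of a weakly singular convolution in the weighted space. -/
noncomputable def contractionFactor (α T a lam : ℝ) : ℝ :=
  a * (lam ^ (-(α / 2)) * T ^ (α / 2) * betaInt (α / 2) α)

/-- Comparing the weights at `tσ` and `t` gains `exp(-λt(1-σ)) ≤ (λt(1-σ))^{-α/2}`. Spending half of
the exponent `α` in this way leaves the integrable `(1-σ)^{α/2-1}` and yields the factor `λ^{-α/2}`,
which is small for large `λ` without any smallness of `T`. -/
lemma norm_conv_le_weight {k : ℝ → Y →L[ℝ] Z} {h : ℝ → Y} {D : ℝ} (hα0 : 0 < α) (hα1 : α ≤ 1)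
    (hlam : 0 < lam) (hk : WeaklySingular α T a k) (hD : 0 ≤ D)
    (hh : ∀ t ∈ Ioc 0 T, ‖h t‖ ≤ D * weight α lam t) (ht : t ∈ Ioc 0 T) :
    ‖conv k h t‖ ≤ contractionFactor α T a lam * D * weight α lam t := by
  have ha := hk.const_nonneg (ht.1.trans_le ht.2)
  have key : ∀ σ ∈ Ioo (0 : ℝ) 1, ‖k (t * (1 - σ)) (h (t * σ))‖ ≤
      a * D * Real.exp (lam * t) * lam ^ (-(α / 2)) * (t ^ (α - 1) * t ^ (α - 1) * t ^ (-(α / 2)))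
        * ((1 - σ) ^ (α / 2 - 1) * σ ^ (α - 1)) := by
    intro σ hσ
    obtain ⟨h1, h2⟩ := scaled_mem ht hσ
    have h3 : 0 < 1 - σ := by linarith [hσ.2]
    have e1 : Real.exp (lam * (t * σ)) ≤
        Real.exp (lam * t) * (lam ^ (-(α / 2)) * t ^ (-(α / 2)) * (1 - σ) ^ (-(α / 2))) := by
      have : lam * (t * σ) = lam * t + -(lam * t * (1 - σ)) := by ring
      rw [this, Real.exp_add, ← Real.mul_rpow hlam.le ht.1.le,
        ← Real.mul_rpow (mul_pos hlam ht.1).le h3.le]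
      exact mul_le_mul_of_nonneg_left (exp_neg_le_rpow_neg (by linarith) (by linarith)
        (mul_pos (mul_pos hlam ht.1) h3)) (Real.exp_pos _).le
    have e2 : (1 - σ) ^ (α / 2 - 1) = (1 - σ) ^ (α - 1) * (1 - σ) ^ (-(α / 2)) := by
      rw [← Real.rpow_add h3]; ring_nf
    calc _ ≤ ‖k (t * (1 - σ))‖ * ‖h (t * σ)‖ := (k _).le_opNorm _
      _ ≤ (a * (t * (1 - σ)) ^ (α - 1)) * (D * weight α lam (t * σ)) :=
          mul_le_mul (hk.bound _ h2) (hh _ h1) (norm_nonneg _)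
            (mul_nonneg ha (Real.rpow_nonneg h2.1.le _))
      _ ≤ (a * (t * (1 - σ)) ^ (α - 1)) * (D * ((t * σ) ^ (α - 1) * (Real.exp (lam * t) *
            (lam ^ (-(α / 2)) * t ^ (-(α / 2)) * (1 - σ) ^ (-(α / 2)))))) := by
          have q1 := Real.rpow_nonneg h2.1.le (α - 1)
          have q2 := Real.rpow_nonneg h1.1.le (α - 1)
          rw [weight]
          gcongr
      _ = _ := by
          rw [Real.mul_rpow ht.1.le h3.le, Real.mul_rpow ht.1.le hσ.1.le, e2]
          ring
  have h1 := intervalIntegral.norm_integral_le_of_norm_le zero_le_one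
    (f := fun σ => k (t * (1 - σ)) (h (t * σ)))
    (by simpa only [uIoc_of_le zero_le_one] using ae_mem_uIoc_imp key)
    ((intervalIntegrable_beta (by linarith) (by linarith) hα0 hα1).const_mul _)
  rw [intervalIntegral.integral_const_mul] at h1
  have e3 : t * (t ^ (α - 1) * t ^ (-(α / 2))) = t ^ (α / 2) := by
    rw [← mul_assoc, mul_rpow_sub_one ht.1, ← Real.rpow_add ht.1]; ring_nf
  have e4 : t ^ (α / 2) ≤ T ^ (α / 2) := Real.rpow_le_rpow ht.1.le ht.2 (by linarith)
  rw [conv_eq_scaled, norm_smul, Real.norm_of_nonneg ht.1.le]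
  calc _ ≤ t * (a * D * Real.exp (lam * t) * lam ^ (-(α / 2)) *
        (t ^ (α - 1) * t ^ (α - 1) * t ^ (-(α / 2))) * betaInt (α / 2) α) :=
        mul_le_mul_of_nonneg_left h1 ht.1.le
    _ = a * (lam ^ (-(α / 2)) * t ^ (α / 2) * betaInt (α / 2) α) * D * weight α lam t := by
        rw [← e3, weight]; ring
    _ ≤ _ := by
        have := betaInt_nonneg (α / 2) α
        have := Real.rpow_nonneg hlam.le (-(α / 2))
        have := (weight_pos (α := α) (lam := lam) ht.1).le
        rw [contractionFactor]
        gcongr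

lemma exists_contractionFactor_le (hα0 : 0 < α) (T a : ℝ) :
    ∃ lam, 0 < lam ∧ contractionFactor α T a lam ≤ 1 / 2 := by
  have h : Filter.Tendsto (contractionFactor α T a) Filter.atTop (nhds 0) := by
    have := ((tendsto_rpow_neg_atTop (show 0 < α / 2 by linarith)).mul_const
      (T ^ (α / 2) * betaInt (α / 2) α)).const_mul a
    simp only [zero_mul, mul_zero] at this
    refine this.congr fun lam => ?_
    rw [contractionFactor, mul_assoc (lam ^ _)]
  obtain ⟨lam, h1, h2⟩ := ((h.eventually_le_const (show (0 : ℝ) < 1 / 2 by norm_num)).and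
    (Filter.eventually_gt_atTop 0)).exists
  exact ⟨lam, h2, h1⟩

/-- Each use of the equation halves the weighted bound for `z`. -/
lemma eq_zero_of_eq_conv {k : ℝ → Y →L[ℝ] Y} {z : ℝ → Y} (hα0 : 0 < α) (hα1 : α ≤ 1)
    (hk : WeaklySingular α T a k) (hz : WeaklySingular α T c z)
    (heq : ∀ t ∈ Ioc 0 T, z t = conv k z t) (ht : t ∈ Ioc 0 T) : z t = 0 := by
  have hc := hz.const_nonneg (ht.1.trans_le ht.2)
  obtain ⟨lam, hl, hq⟩ := exists_contractionFactor_le hα0 T a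
  have key : ∀ n : ℕ, ∀ t ∈ Ioc 0 T, ‖z t‖ ≤ (1 / 2) ^ n * c * weight α lam t := by
    intro n
    induction n with
    | zero =>
      intro t ht
      simpa using (hz.bound t ht).trans (mul_le_mul_of_nonneg_left (rpow_le_weight hl.le ht.1) hc)
    | succ n ih =>
      intro t ht
      rw [heq t ht]
      refine (norm_conv_le_weight hα0 hα1 hl hk (by positivity) ih ht).trans ?_
      rw [pow_succ, mul_comm _ (1 / 2 : ℝ), mul_assoc (1 / 2 : ℝ)]
      exact mul_le_mul_of_nonneg_right (mul_le_mul_of_nonneg_right hq (by positivity))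
        (weight_pos ht.1).le
  have hlim : Filter.Tendsto (fun n : ℕ => (1 / 2 : ℝ) ^ n * c * weight α lam t) Filter.atTop
      (nhds (0 * c * weight α lam t)) :=
    ((tendsto_pow_atTop_nhds_zero_of_lt_one (by norm_num) (by norm_num)).mul_const c).mul_const _
  have := ge_of_tendsto' hlim fun n => key n t ht
  simpa using this

section Existence

open BoundedContinuousFunction

open Classical in
/-- The weakly singular function on `(0, T]` with a given bounded continuous density. -/
noncomputable def unweight (α T lam : ℝ) (ζ : Ioc 0 T →ᵇ Y) (t : ℝ) : Y :=
  weight α lam t • if h : t ∈ Ioc 0 T then ζ ⟨t, h⟩ else 0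

lemma unweight_apply (ζ : Ioc 0 T →ᵇ Y) (ht : t ∈ Ioc 0 T) :
    unweight α T lam ζ t = weight α lam t • ζ ⟨t, ht⟩ := by
  rw [unweight, dif_pos ht]

lemma norm_unweight_le (ζ : Ioc 0 T →ᵇ Y) (ht : t ∈ Ioc 0 T) :
    ‖unweight α T lam ζ t‖ ≤ ‖ζ‖ * weight α lam t := by
  rw [unweight_apply ζ ht, norm_smul, Real.norm_of_nonneg (weight_pos ht.1).le, mul_comm]
  exact mul_le_mul_of_nonneg_right (ζ.norm_coe_le_norm _) (weight_pos ht.1).le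

lemma continuousOn_unweight (ζ : Ioc 0 T →ᵇ Y) : ContinuousOn (unweight α T lam ζ) (Ioc 0 T) := by
  refine continuousOn_weight.smul ?_
  rw [continuousOn_iff_continuous_domRestrict]
  refine ζ.continuous.congr fun x => ?_
  rw [domRestrict_apply, dif_pos x.2]

lemma weaklySingular_unweight (hlam : 0 ≤ lam) (ζ : Ioc 0 T →ᵇ Y) :
    WeaklySingular α T (‖ζ‖ * Real.exp (lam * T)) (unweight α T lam ζ) :=
  ⟨continuousOn_unweight ζ, fun t ht => (norm_unweight_le ζ ht).trans (by
    rw [mul_assoc]; exact mul_le_mul_of_nonneg_left (weight_le hlam ht) (norm_nonneg _))⟩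

/-- The bounded continuous density of a weakly singular function. -/
noncomputable def density (hlam : 0 ≤ lam) {h : ℝ → Y} (hh : WeaklySingular α T c h) :
    Ioc 0 T →ᵇ Y :=
  .ofNormedAddCommGroup (fun t => (weight α lam t)⁻¹ • h t)
    (continuousOn_iff_continuous_domRestrict.1
      ((continuousOn_weight.inv₀ fun _ hx => (weight_pos hx.1).ne').smul hh.cont)) c
    fun t => by
      have hw := weight_pos (α := α) (lam := lam) t.2.1
      rw [norm_smul, norm_inv, Real.norm_of_nonneg hw.le, inv_mul_le_iff₀ hw, mul_comm]
      exact (hh.bound t t.2).trans (mul_le_mul_of_nonneg_left (rpow_le_weight hlam t.2.1)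
        (hh.const_nonneg (t.2.1.trans_le t.2.2)))

lemma unweight_density (hlam : 0 ≤ lam) {h : ℝ → Y} (hh : WeaklySingular α T c h)
    (ht : t ∈ Ioc 0 T) : unweight α T lam (density hlam hh) t = h t := by
  rw [unweight_apply _ ht]
  exact smul_inv_smul₀ (weight_pos ht.1).ne' _

lemma norm_density_le (hlam : 0 ≤ lam) {h : ℝ → Y} (hT : 0 < T) (hh : WeaklySingular α T c h) :
    ‖density hlam hh‖ ≤ c :=
  BoundedContinuousFunction.norm_ofNormedAddCommGroup_le _ (hh.const_nonneg hT) _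

lemma conv_sub {k : ℝ → Y →L[ℝ] Z} {h h' : ℝ → Y} {c' : ℝ} (hα0 : 0 < α) (hα1 : α ≤ 1)
    (hk : WeaklySingular α T a k) (hh : WeaklySingular α T c h) (hh' : WeaklySingular α T c' h')
    (ht : t ∈ Ioc 0 T) : conv k (fun s => h s - h' s) t = conv k h t - conv k h' t := by
  simp only [conv, map_sub]
  exact intervalIntegral.integral_sub (intervalIntegrable_conv hα0 hα1 hk hh ht)
    (intervalIntegrable_conv hα0 hα1 hk hh' ht)

/-- Weakly singular Volterra equations of the second kind are solvable. -/
theorem exists_volterra [CompleteSpace Y] {k : ℝ → Y →L[ℝ] Y} (hα0 : 0 < α) (hα1 : α ≤ 1)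
    (hT : 0 < T) (hk : WeaklySingular α T a k) :
    ∃ C : ℝ, 0 ≤ C ∧ ∀ (z₀ : ℝ → Y) (c : ℝ), WeaklySingular α T c z₀ →
      ∃ z, WeaklySingular α T (C * c) z ∧ ∀ t ∈ Ioc 0 T, z t = z₀ t + conv k z t := by
  obtain ⟨lam, hl, hq⟩ := exists_contractionFactor_le hα0 T a
  -- The `2` comes from the contraction ratio `1/2`, the exponential from removing the weight; `lam`
  -- depends on the kernel bound only, not on `z₀`.
  refine ⟨2 * Real.exp (lam * T), by positivity, fun z₀ c hz₀ => ?_⟩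
  have hu := fun ζ : Ioc 0 T →ᵇ Y => weaklySingular_unweight (α := α) hl.le ζ
  -- The right-hand side of the equation, carried over to densities with respect to the weight. They
  -- form a complete space, and a fixed point is a solution.
  let Ψ : (Ioc 0 T →ᵇ Y) → (Ioc 0 T →ᵇ Y) := fun ζ =>
    density hl.le (hz₀.add (WeaklySingular.conv hα0 hα1 hT hk (hu ζ)))
  have hΨ : ∀ ζ ζ' : Ioc 0 T →ᵇ Y, dist (Ψ ζ) (Ψ ζ') ≤ 1 / 2 * dist ζ ζ' := by
    intro ζ ζ'
    rw [dist_le (by positivity)]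
    intro t
    have hw := weight_pos (α := α) (lam := lam) t.2.1
    have h1 : Ψ ζ t - Ψ ζ' t = (weight α lam t)⁻¹ •
        conv k (fun s => unweight α T lam ζ s - unweight α T lam ζ' s) t := by
      rw [conv_sub hα0 hα1 hk (hu ζ) (hu ζ') t.2]
      change (weight α lam t)⁻¹ • (z₀ t + conv k (unweight α T lam ζ) t) -
        (weight α lam t)⁻¹ • (z₀ t + conv k (unweight α T lam ζ') t) = _
      rw [← smul_sub, add_sub_add_left_eq_sub]
    have h2 : ∀ s ∈ Ioc 0 T, ‖unweight α T lam ζ s - unweight α T lam ζ' s‖ ≤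
        dist ζ ζ' * weight α lam s := by
      intro s hs
      rw [unweight_apply _ hs, unweight_apply _ hs, ← smul_sub, norm_smul,
        Real.norm_of_nonneg (weight_pos hs.1).le, mul_comm, ← dist_eq_norm]
      exact mul_le_mul_of_nonneg_right (dist_coe_le_dist _) (weight_pos hs.1).le
    rw [dist_eq_norm, h1, norm_smul, norm_inv, Real.norm_of_nonneg hw.le, inv_mul_le_iff₀ hw,
      mul_comm (weight α lam t)]
    exact (norm_conv_le_weight hα0 hα1 hl hk dist_nonneg h2 t.2).trans
      (mul_le_mul_of_nonneg_right (mul_le_mul_of_nonneg_right hq dist_nonneg) hw.le)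
  have hcontr : ContractingWith (1 / 2) Ψ :=
    ⟨by rw [← NNReal.coe_lt_coe]; norm_num,
      LipschitzWith.of_dist_le_mul fun ζ ζ' => by simpa using hΨ ζ ζ'⟩
  set ζ := hcontr.fixedPoint Ψ with hζ
  have hfix : Ψ ζ = ζ := hcontr.fixedPoint_isFixedPt
  have h0 : ‖Ψ 0‖ ≤ c := by
    refine (BoundedContinuousFunction.norm_le (hz₀.const_nonneg hT)).2 fun t => ?_
    have h3 : conv k (unweight α T lam 0) t = (0 : Y) := by
      simp [conv, unweight]
    have h4 : Ψ 0 t = density hl.le hz₀ t := by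
      change (weight α lam t)⁻¹ • (z₀ t + conv k (unweight α T lam 0) t) = _
      rw [h3, add_zero]; rfl
    rw [h4]
    exact (BoundedContinuousFunction.norm_coe_le_norm _ _).trans (norm_density_le hl.le hT hz₀)
  have hn : ‖ζ‖ ≤ 2 * c := by
    have h5 := hΨ ζ 0
    rw [hfix, dist_zero_right, dist_eq_norm] at h5
    have h6 := norm_sub_norm_le ζ (Ψ 0)
    linarith
  refine ⟨unweight α T lam ζ, (hu ζ).mono_const ?_, fun t ht => ?_⟩
  · calc _ ≤ 2 * c * Real.exp (lam * T) := by gcongr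
      _ = _ := by ring
  · have := unweight_density hl.le (hz₀.add (WeaklySingular.conv hα0 hα1 hT hk (hu ζ))) ht
    change unweight α T lam (Ψ ζ) t = _ at this
    rwa [hfix] at this

end Existence

end TemperedVolterra

/-! ### The differentiated equation, uniqueness and regularity. -/

namespace TemperedVolterra

variable {Y Z : Type*} [NormedAddCommGroup Y] [NormedSpace ℝ Y]
  [NormedAddCommGroup Z] [NormedSpace ℝ Z] {α T a c t : ℝ}

lemma conv_neg_left (k : ℝ → Y →L[ℝ] Z) (h : ℝ → Y) (t : ℝ) :
    conv (fun s => -k s) h t = -conv k h t := by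
  simp [conv]

lemma conv_sub_left {k k' : ℝ → Y →L[ℝ] Z} {h : ℝ → Y} {a' : ℝ} (hα0 : 0 < α) (hα1 : α ≤ 1)
    (hk : WeaklySingular α T a k) (hk' : WeaklySingular α T a' k') (hh : WeaklySingular α T c h)
    (ht : t ∈ Ioc 0 T) : conv (fun s => k s - k' s) h t = conv k h t - conv k' h t := by
  simp only [conv, sub_apply]
  exact intervalIntegral.integral_sub (intervalIntegrable_conv hα0 hα1 hk hh ht)
    (intervalIntegrable_conv hα0 hα1 hk' hh ht)

lemma conv_add {k : ℝ → Y →L[ℝ] Z} {h h' : ℝ → Y} {c' : ℝ} (hα0 : 0 < α) (hα1 : α ≤ 1)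
    (hk : WeaklySingular α T a k) (hh : WeaklySingular α T c h) (hh' : WeaklySingular α T c' h')
    (ht : t ∈ Ioc 0 T) : conv k (fun s => h s + h' s) t = conv k h t + conv k h' t := by
  simp only [conv, map_add]
  exact intervalIntegral.integral_add (intervalIntegrable_conv hα0 hα1 hk hh ht)
    (intervalIntegrable_conv hα0 hα1 hk hh' ht)

lemma exists_weaklySingular_of_continuousOn {h : ℝ → Y} (hα1 : α ≤ 1)
    (hh : ContinuousOn h (Icc 0 T)) : ∃ c, WeaklySingular α T c h := by
  obtain ⟨D, hD⟩ := isCompact_Icc.exists_bound_of_continuousOn hh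
  exact ⟨_, .of_bounded (c := max D 0) hα1 (hh.mono Ioc_subset_Icc_self) (le_max_right _ _)
    fun t ht => (hD t (Ioc_subset_Icc_self ht)).trans (le_max_left _ _)⟩

namespace SmoothingFamily

variable [CompleteSpace Y] {K : Y →L[ℝ] Y} {E G : ℝ → Y →L[ℝ] Y}

/-- The operator kernel `A (E * b)`. -/
noncomputable def resolventKernel (E G b : ℝ → Y →L[ℝ] Y) : ℝ → Y →L[ℝ] Y :=
  smoothed (fun t => ContinuousLinearMap.compL ℝ Y Y Y (E t))
    (fun t => ContinuousLinearMap.compL ℝ Y Y Y (G t)) b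

variable {b l : ℝ → Y →L[ℝ] Y}

lemma weaklySingular_resolventKernel (S : SmoothingFamily K E G) (hα0 : 0 < α) (hα1 : α ≤ 1)
    (hb : LipschitzSingular α T a b) :
    WeaklySingular α T ((2 + 4 / α) * a) (resolventKernel E G b) :=
  S.compL.weaklySingular_smoothed hα0 hα1 hb

/-- Left compositions with `K`, `E`, `G` again form a smoothing family, so the results on
vector-valued `φ` apply to the operator-valued `b`. -/
lemma comp_resolventKernel (S : SmoothingFamily K E G) (hα0 : 0 < α) (hα1 : α ≤ 1)
    (hb : LipschitzSingular α T a b) (ht : t ∈ Ioc 0 T) :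
    K.comp (resolventKernel E G b t) = ∫ s in (0 : ℝ)..t, (b s - resolventKernel E G b s) :=
  (S.compL.apply_smoothed hα0 hα1 hb ht).trans (S.compL.conv_E_eq_integral hα0 hα1 hb ht)

lemma apply_conv (hα0 : 0 < α) (hα1 : α ≤ 1) {k : ℝ → Y →L[ℝ] Y} {h : ℝ → Y}
    (hk : WeaklySingular α T a k) (hh : WeaklySingular α T c h) (ht : t ∈ Ioc 0 T)
    (K : Y →L[ℝ] Y) : K (conv k h t) = conv (fun s => K.comp (k s)) h t :=
  (ContinuousLinearMap.intervalIntegral_comp_comm K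
    (intervalIntegrable_conv hα0 hα1 hk hh ht)).symm

/-- Convolve `comp_resolventKernel` with `h` and take the inner integral outside by Fubini. With `N`
the resolvent kernel, this says that `w = K (N * h)` satisfies `w' + A w = b * h`, `w(0) = 0`, in
integrated form. -/
lemma apply_conv_resolventKernel (S : SmoothingFamily K E G) (hα0 : 0 < α) (hα1 : α ≤ 1)
    (hb : LipschitzSingular α T a b) {h : ℝ → Y} (hh : WeaklySingular α T c h)
    (ht : t ∈ Ioc 0 T) :
    K (conv (resolventKernel E G b) h t) =
      ∫ s in (0 : ℝ)..t, (conv b h s - conv (resolventKernel E G b) h s) := by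
  have hN := S.weaklySingular_resolventKernel hα0 hα1 hb
  have hbw := hb.weaklySingular hα1
  rw [apply_conv hα0 hα1 hN hh ht, conv_congr
    (fun s hs => S.comp_resolventKernel hα0 hα1 hb hs) (fun _ _ => rfl) ht,
    ← integral_conv_left ht.1.le ((hbw.sub hN).intervalIntegrable hα0 ht.1.le ht.2)
      (hh.intervalIntegrable hα0 ht.1.le ht.2)]
  exact integral_congr_Ioc (fun s hs => conv_sub_left hα0 hα1 hbw hN hh hs) ht

/-- The differentiated equation has a solution, with `z = A w`. -/
theorem exists_differentiated_solution (S : SmoothingFamily K E G) (hα0 : 0 < α) (hα1 : α ≤ 1)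
    (hT : 0 < T) (hb : LipschitzSingular α T a b) :
    ∃ C : ℝ, 0 ≤ C ∧ ∀ (w₀ : Y) (φ : ℝ → Y) (c : ℝ), WeaklySingular α T c (fun t => G t w₀) →
      LipschitzSingular α T c φ → ∃ z, WeaklySingular α T (C * c) z ∧
        ∀ t ∈ Ioc 0 T, K (z t) = w₀ + ∫ s in (0 : ℝ)..t, (φ s - conv b z s - z s) := by
  have hN := S.weaklySingular_resolventKernel hα0 hα1 hb
  have hbw := hb.weaklySingular hα1
  -- Duhamel's formula with `A` applied: `z = G w₀ + A (E * φ) - N * z`, where `N = A (E * b)`.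
  obtain ⟨C, hC, hvol⟩ := exists_volterra hα0 hα1 hT hN.neg
  refine ⟨C * (1 + (2 + 4 / α)), by positivity, fun w₀ φ c hw₀ hφ => ?_⟩
  have hΦ := S.weaklySingular_smoothed hα0 hα1 hφ
  obtain ⟨z, hz, hzeq⟩ := hvol _ _ (hw₀.add hΦ)
  refine ⟨z, hz.mono_const (by ring_nf; rfl), fun t ht => ?_⟩
  have ii : ∀ {c : ℝ} {h : ℝ → Y}, WeaklySingular α T c h → IntervalIntegrable h volume 0 t :=
    fun hh => hh.intervalIntegrable hα0 ht.1.le ht.2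
  have hφw := hφ.weaklySingular hα1
  have hbz := WeaklySingular.conv hα0 hα1 hT hbw hz
  have hNz := WeaklySingular.conv hα0 hα1 hT hN hz
  rw [hzeq t ht, conv_neg_left, map_add, map_add, map_neg, S.apply_G t ht.1,
    S.apply_smoothed hα0 hα1 hφ ht, S.E_eq_sub_integral hα0 hw₀ ht,
    S.conv_E_eq_integral hα0 hα1 hφ ht, S.apply_conv_resolventKernel hα0 hα1 hb hz ht]
  have h1 : ∫ s in (0 : ℝ)..t, (φ s - conv b z s - z s) =
      ∫ s in (0 : ℝ)..t, ((φ s - smoothed E G φ s) - G s w₀ -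
        (conv b z s - conv (resolventKernel E G b) z s)) := by
    refine integral_congr_Ioc (fun s hs => ?_) ht
    have h2 := hzeq s hs
    rw [conv_neg_left] at h2
    rw [sub_eq_sub_iff_add_eq_add, h2]
    abel
  rw [h1, intervalIntegral.integral_sub (ii ((hφw.sub hΦ).sub hw₀)) (ii (hbz.sub hNz)),
    intervalIntegral.integral_sub (ii (hφw.sub hΦ)) (ii hw₀)]
  abel

/-- `K e + ∫ e = 0` has only the trivial solution. -/
lemma eq_zero_of_apply_eq_neg_integral (S : SmoothingFamily K E G) (hα0 : 0 < α) (hα1 : α ≤ 1)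
    {e : ℝ → Y} (he : WeaklySingular α T c e)
    (heq : ∀ t ∈ Ioc 0 T, K (e t) = -∫ s in (0 : ℝ)..t, e s) (ht : t ∈ Ioc 0 T) : e t = 0 := by
  have hE := S.weaklySingular_E (T := T) hα1
  -- Convolve the hypothesis with `E`, which commutes with `K` and with integration. Since also `∫ E
  -- * e = K (∫ e - E * e)`, the terms `K (E * e)` cancel and `K ∫ e = 0` remains.
  have h1 : K (conv E e t) = -∫ s in (0 : ℝ)..t, conv E e s := by
    have hcomm : conv (fun s => K.comp (E s)) e t = conv (fun s => (E s).comp K) e t :=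
      conv_congr (fun s hs => ContinuousLinearMap.ext fun y => S.comm s hs.1 y)
        (fun _ _ => rfl) ht
    have hK : conv (fun s => (E s).comp K) e t = conv E (fun s => K (e s)) t := rfl
    rw [apply_conv hα0 hα1 hE he ht, hcomm, hK, conv_congr (fun _ _ => rfl) heq ht,
      integral_conv_right ht.1.le (hE.intervalIntegrable hα0 ht.1.le ht.2)
        (he.intervalIntegrable hα0 ht.1.le ht.2)]
    simp [conv]
  rw [S.integral_conv_E hα0 hα1 he ht, map_sub, neg_sub, eq_comm, sub_eq_self] at h1
  have h2 := S.injective _ h1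
  exact S.injective _ (by rw [heq t ht, h2, neg_zero])

/-- With `N = A (E * l)`, the function `e = d + N * d` satisfies `K e = -∫ e` and so vanishes; then
`d = -N * d` is a homogeneous Volterra equation. -/
theorem eq_zero_of_homogeneous (S : SmoothingFamily K E G) (hα0 : 0 < α) (hα1 : α ≤ 1)
    (hl : LipschitzSingular α T a l) {d : ℝ → Y} (hd : WeaklySingular α T c d)
    (heq : ∀ t ∈ Ioc 0 T, K (d t) = -∫ s in (0 : ℝ)..t, (d s + conv l d s)) (ht : t ∈ Ioc 0 T) :
    d t = 0 := by
  have hT := ht.1.trans_le ht.2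
  have hN := S.weaklySingular_resolventKernel hα0 hα1 hl
  have hld := WeaklySingular.conv hα0 hα1 hT (hl.weaklySingular hα1) hd
  have hNd := WeaklySingular.conv hα0 hα1 hT hN hd
  have he : ∀ t ∈ Ioc 0 T, d t + conv (resolventKernel E G l) d t = 0 := by
    intro t ht
    refine S.eq_zero_of_apply_eq_neg_integral hα0 hα1 (hd.add hNd) (fun t ht => ?_) ht
    have ii : ∀ {c : ℝ} {h : ℝ → Y}, WeaklySingular α T c h → IntervalIntegrable h volume 0 t :=
      fun hh => hh.intervalIntegrable hα0 ht.1.le ht.2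
    rw [map_add, heq t ht, S.apply_conv_resolventKernel hα0 hα1 hl hd ht,
      intervalIntegral.integral_add (ii hd) (ii hld), intervalIntegral.integral_sub (ii hld) (ii hNd),
      intervalIntegral.integral_add (ii hd) (ii hNd)]
    abel
  refine eq_zero_of_eq_conv hα0 hα1 hN.neg hd (fun s hs => ?_) ht
  rw [conv_neg_left]
  exact eq_neg_of_add_eq_zero_left (he s hs)

/-- The regularity theorem for the integrated equation. -/
theorem regularity (S : SmoothingFamily K E G) (hα0 : 0 < α) (hα1 : α ≤ 1)
    (hT : 0 < T) (hb : LipschitzSingular α T a b) (hl : LipschitzSingular α T a l)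
    (hbl : ∀ t ∈ Ioc 0 T, K.comp (b t) = (l t).comp K) :
    ∃ C : ℝ, 0 ≤ C ∧ ∀ (y₀ : Y) (u f F : ℝ → Y) (c : ℝ),
      ContinuousOn u (Icc 0 T) → ContinuousOn f (Icc 0 T) →
      (∀ t ∈ Ioc 0 T, HasDerivWithinAt f (F t) (Ioc 0 T) t) →
      LipschitzSingular α T c F → WeaklySingular α T c (fun t => G t (f 0 - y₀)) →
      (∀ t ∈ Ioc 0 T, K (u t) = K (K y₀) + ∫ s in (0 : ℝ)..t, (K (f s) - u s - conv l u s)) →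
      ∃ z v : ℝ → Y, WeaklySingular α T (C * (c + ‖y₀‖)) z ∧ WeaklySingular α T (C * (c + ‖y₀‖)) v ∧
        (∀ t ∈ Ioc 0 T, HasDerivWithinAt u (K (z t)) (Ioc 0 T) t) ∧
        ∀ t ∈ Ioc 0 T, HasDerivWithinAt (fun s => K (z s)) (v t) (Ioc 0 T) t := by
  have hbw := hb.weaklySingular hα1
  have hlw := hl.weaklySingular hα1
  have ha := hbw.const_nonneg hT
  obtain ⟨C, hC, hex⟩ := S.exists_differentiated_solution hα0 hα1 hT hb
  have hB := betaInt_nonneg α α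
  -- The three summands bound `φ`, `b * z` and `z`, whose combination is `v`; the factor `1 + a`
  -- absorbs the term `b(·) y₀` of `φ`.
  refine ⟨(1 + a * C * T ^ α * betaInt α α + C) * (1 + a), by positivity,
    fun y₀ u f F c hu hf hfF hF hw₀ heq => ?_⟩
  have hc := hw₀.const_nonneg hT
  have hφ : LipschitzSingular α T (c + ‖y₀‖ * a) (fun t => F t - b t y₀) := by
    refine (hF.sub (hb.clm_apply (ContinuousLinearMap.apply ℝ Y y₀))).mono_const ?_
    refine add_le_add le_rfl (mul_le_mul_of_nonneg_right ?_ ha)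
    exact ContinuousLinearMap.opNorm_le_bound _ (norm_nonneg _) fun L => by
      simpa [mul_comm] using L.le_opNorm y₀
  obtain ⟨z, hz, hzeq⟩ := hex (f 0 - y₀) _ (c + ‖y₀‖ * a)
    (hw₀.mono_const (le_add_of_nonneg_right (by positivity))) hφ
  have hconst : c + ‖y₀‖ * a ≤ (1 + a) * (c + ‖y₀‖) := by
    nlinarith [mul_nonneg ha hc, norm_nonneg y₀]
  have hbz := WeaklySingular.conv hα0 hα1 hT hbw hz
  have hv := ((hφ.weaklySingular hα1).sub hbz).sub hz
  have hFw := hF.weaklySingular hα1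
  have hKz := hz.clm_apply K
  have hy₀ : WeaklySingular α T (‖y₀‖ * T ^ (1 - α)) (fun _ : ℝ => y₀) :=
    .of_bounded hα1 continuousOn_const (norm_nonneg _) fun _ _ => le_rfl
  have hyc : ContinuousOn (fun t => y₀ + ∫ s in (0 : ℝ)..t, z s) (Icc 0 T) :=
    continuousOn_const.add (hz.continuousOn_integral hα0 hT.le)
  obtain ⟨c₁, hyw⟩ := exists_weaklySingular_of_continuousOn hα1 hyc
  have hKyw := hyw.clm_apply K
  obtain ⟨c₂, huw⟩ := exists_weaklySingular_of_continuousOn hα1 hu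
  obtain ⟨c₃, hfw⟩ : ∃ c₃, WeaklySingular α T c₃ (fun s => K (f s)) :=
    exists_weaklySingular_of_continuousOn hα1 (K.continuous.comp_continuousOn hf)
  have hzi : ∀ t ∈ Ioc 0 T, ∫ s in (0 : ℝ)..t, K (z s) = K (∫ s in (0 : ℝ)..t, z s) := fun t ht =>
    ContinuousLinearMap.intervalIntegral_comp_comm _ (hz.intervalIntegrable hα0 ht.1.le ht.2)
  obtain ⟨c₄, hziw⟩ := exists_weaklySingular_of_continuousOn hα1
    (hz.continuousOn_integral hα0 hT.le)
  -- Integrating the derivative of the data back: `y = y₀ + ∫ z`, the candidate for `A u`, satisfies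
  -- the original equation `K z + y + b * y = f`.
  have heqw : ∀ t ∈ Ioc 0 T, K (z t) + (y₀ + ∫ s in (0 : ℝ)..t, z s) +
      conv b (fun t => y₀ + ∫ s in (0 : ℝ)..t, z s) t = f t := by
    intro t ht
    have ii : ∀ {c : ℝ} {h : ℝ → Y}, WeaklySingular α T c h → IntervalIntegrable h volume 0 t :=
      fun hh => hh.intervalIntegrable hα0 ht.1.le ht.2
    have hby : WeaklySingular α T _ (fun s => b s y₀) := hbw.clm_apply (ContinuousLinearMap.apply ℝ Y y₀)
    have h1 : ∫ s in (0 : ℝ)..t, F s = f t - f 0 := by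
      refine intervalIntegral.integral_eq_sub_of_hasDerivAt_of_le ht.1.le
        (hf.mono (Icc_subset_Icc_right ht.2)) (fun x hx => ?_) (ii hFw)
      exact (hfF x ⟨hx.1, hx.2.le.trans ht.2⟩).hasDerivAt
        (Ioc_mem_nhds hx.1 (hx.2.trans_le ht.2))
    rw [hzeq t ht, intervalIntegral.integral_sub (ii ((hφ.weaklySingular hα1).sub hbz)) (ii hz),
      intervalIntegral.integral_sub (ii (hφ.weaklySingular hα1)) (ii hbz),
      intervalIntegral.integral_sub (ii hFw) (ii hby), h1,
      conv_add hα0 hα1 hbw hy₀ hziw ht, ← integral_conv_right ht.1.le (hbw.intervalIntegrable hα0 ht.1.le ht.2) (ii hz),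
      conv_eq_comp_sub b (fun _ => y₀)]
    abel
  -- Applying `K` once more, with `K (b * y) = l * (K y)` by `hbl`, shows that `K y` obeys the
  -- integrated equation of `u`; their difference solves the homogeneous one.
  have huu : ∀ t ∈ Ioc 0 T, u t = K (y₀ + ∫ s in (0 : ℝ)..t, z s) := by
    intro t ht
    rw [← sub_eq_zero]
    refine S.eq_zero_of_homogeneous hα0 hα1 hl (huw.sub hKyw) (fun t ht => ?_) ht
    have ii : ∀ {c : ℝ} {h : ℝ → Y}, WeaklySingular α T c h → IntervalIntegrable h volume 0 t :=
      fun hh => hh.intervalIntegrable hα0 ht.1.le ht.2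
    have hlu := WeaklySingular.conv hα0 hα1 hT hlw huw
    have hly := WeaklySingular.conv hα0 hα1 hT hlw hKyw
    have h1 : ∀ s ∈ Ioc 0 T, K (K (z s)) = K (f s) - K (y₀ + ∫ r in (0 : ℝ)..s, z r) -
        conv l (fun s => K (y₀ + ∫ r in (0 : ℝ)..s, z r)) s := by
      intro s hs
      have h2 : conv l (fun s => K (y₀ + ∫ r in (0 : ℝ)..s, z r)) s =
          K (conv b (fun s => y₀ + ∫ r in (0 : ℝ)..s, z r) s) := by
        rw [apply_conv hα0 hα1 hbw hyw hs, conv_congr hbl (fun _ _ => rfl) hs]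
        rfl
      rw [h2, ← heqw s hs, map_add, map_add]
      abel
    have h3 : K (K (∫ s in (0 : ℝ)..t, z s)) =
        ∫ s in (0 : ℝ)..t, (K (f s) - K (y₀ + ∫ r in (0 : ℝ)..s, z r) -
          conv l (fun s => K (y₀ + ∫ r in (0 : ℝ)..s, z r)) s) := by
      rw [← hzi t ht, ← ContinuousLinearMap.intervalIntegral_comp_comm _ (ii hKz)]
      exact integral_congr_Ioc h1 ht
    rw [map_sub, heq t ht, map_add K y₀, map_add K, h3, add_sub_add_left_eq_sub,
      ← intervalIntegral.integral_sub (ii ((hfw.sub huw).sub hlu)) (ii ((hfw.sub hKyw).sub hly)),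
      ← intervalIntegral.integral_neg]
    refine integral_congr_Ioc (fun s hs => ?_) ht
    rw [conv_sub hα0 hα1 hlw huw hKyw hs]
    abel
  have hn : 0 ≤ c + ‖y₀‖ := add_nonneg hc (norm_nonneg _)
  refine ⟨z, _, hz.mono_const ?_, hv.mono_const ?_, fun t ht => ?_, fun t ht => ?_⟩
  · calc _ ≤ C * ((1 + a) * (c + ‖y₀‖)) := mul_le_mul_of_nonneg_left hconst hC
      _ ≤ (1 + a * C * T ^ α * betaInt α α + C) * ((1 + a) * (c + ‖y₀‖)) := by
          refine mul_le_mul_of_nonneg_right ?_ (by positivity)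
          have : 0 ≤ a * C * T ^ α * betaInt α α := by positivity
          linarith
      _ = _ := by ring
  · calc _ = (1 + a * C * T ^ α * betaInt α α + C) * (c + ‖y₀‖ * a) := by ring
      _ ≤ (1 + a * C * T ^ α * betaInt α α + C) * ((1 + a) * (c + ‖y₀‖)) :=
          mul_le_mul_of_nonneg_left hconst (by positivity)
      _ = _ := by ring
  · refine ((hKz.hasDerivWithinAt_integral hα0 ht).const_add (K y₀)).congr (fun s hs => ?_) ?_
    · rw [huu s hs, map_add, hzi s hs]
    · rw [huu t ht, map_add, hzi t ht]
  · exact ((hv.hasDerivWithinAt_integral hα0 ht).const_add (f 0 - y₀)).congr hzeq (hzeq t ht)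

end SmoothingFamily

end TemperedVolterra

/-! ### Spectral decomposition of `A` and the semigroup. -/

namespace TemperedVolterra

section Spectral

variable {𝕜 H : Type*} [RCLike 𝕜] [NormedAddCommGroup H] [InnerProductSpace 𝕜 H]

/-- `K` is a bounded two-sided inverse of `A`. -/
structure IsBoundedInverse (A : H →ₗ.[𝕜] H) (K : H →L[𝕜] H) : Prop where
  left : ∀ x : A.domain, K (A x) = x
  right : ∀ y : H, ∃ h : K y ∈ A.domain, A ⟨K y, h⟩ = y

variable {A : H →ₗ.[𝕜] H} {K : H →L[𝕜] H}

lemma app_of_mem {x : H} (hx : x ∈ A.domain) : app A x = A ⟨x, hx⟩ := dif_pos hx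

lemma mem_eigenspace_iff {μ : ℝ} {x : H} :
    x ∈ eigenspace A μ ↔ ∃ h : x ∈ A.domain, A ⟨x, h⟩ = (μ : 𝕜) • x := by
  simp only [eigenspace, Submodule.mem_map, LinearMap.mem_ker, LinearMap.sub_apply,
    LinearMap.smul_apply, Submodule.subtype_apply, sub_eq_zero]
  constructor
  · rintro ⟨y, hy, rfl⟩
    exact ⟨y.2, hy⟩
  · rintro ⟨h, hx⟩
    exact ⟨⟨x, h⟩, hx, rfl⟩

namespace IsBoundedInverse

lemma injective (hK : IsBoundedInverse A K) {y : H} (hy : K y = 0) : y = 0 := by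
  obtain ⟨h, h'⟩ := hK.right y
  rw [← h']
  have : (⟨K y, h⟩ : A.domain) = 0 := Subtype.ext hy
  rw [this, LinearPMap.map_zero]

lemma mem_domain (hK : IsBoundedInverse A K) (y : H) : K y ∈ A.domain := (hK.right y).1

lemma app_apply (hK : IsBoundedInverse A K) (y : H) : app A (K y) = y := by
  rw [app_of_mem (hK.mem_domain y)]
  exact (hK.right y).2

lemma apply_app (hK : IsBoundedInverse A K) {x : H} (hx : x ∈ A.domain) : K (app A x) = x := by
  rw [app_of_mem hx]
  exact hK.left ⟨x, hx⟩

/-- Stating the eigenvalue equation through the bounded `K` removes the domain condition and makes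
closedness of the eigenspaces evident. -/
lemma mem_eigenspace_iff (hK : IsBoundedInverse A K) {μ : ℝ} {x : H} :
    x ∈ eigenspace A μ ↔ x = (μ : 𝕜) • K x := by
  rw [TemperedVolterra.mem_eigenspace_iff]
  constructor
  · rintro ⟨h, hx⟩
    rw [← map_smul, ← hx]
    exact (hK.left ⟨x, h⟩).symm
  · intro hx
    have hmem : x ∈ A.domain := by
      rw [hx]; exact A.domain.smul_mem _ (hK.mem_domain x)
    refine ⟨hmem, ?_⟩
    obtain ⟨h, h'⟩ := hK.right x
    have : (⟨x, hmem⟩ : A.domain) = (μ : 𝕜) • ⟨K x, h⟩ := Subtype.ext hx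
    rw [this, LinearPMap.map_smul, h']

lemma topologicalClosure_eigenspace (hK : IsBoundedInverse A K) (μ : ℝ) :
    (eigenspace A μ).topologicalClosure = eigenspace A μ := by
  refine IsClosed.submodule_topologicalClosure_eq ?_
  have : (eigenspace A μ : Set H) = {x | x = (μ : 𝕜) • K x} := by
    ext x; exact hK.mem_eigenspace_iff
  rw [this]
  exact isClosed_eq continuous_id (by fun_prop)

end IsBoundedInverse

variable [CompleteSpace H]

lemma inner_apply_left_of_isSelfAdjoint {B : H →ₗ.[𝕜] H} (hB : IsSelfAdjoint B) (x y : B.domain) :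
    inner 𝕜 (B x) (y : H) = inner 𝕜 (x : H) (B y) := by
  have h := LinearPMap.adjoint_isFormalAdjoint (T := B) hB.dense_domain
  rw [LinearPMap.isSelfAdjoint_def.1 hB] at h
  exact h x y

lemma inner_inverse_left (hA : IsAdmissible A) (hK : IsBoundedInverse A K) (x y : H) :
    inner 𝕜 (K x) y = inner 𝕜 x (K y) := by
  obtain ⟨h1, h2⟩ := hK.right x
  obtain ⟨h3, h4⟩ := hK.right y
  have := inner_apply_left_of_isSelfAdjoint hA.selfAdjoint ⟨K x, h1⟩ ⟨K y, h3⟩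
  rw [h2, h4] at this
  exact this.symm

lemma eigenspace_eq_bot (hA : IsAdmissible A) {μ : ℝ} (hμ : μ ≤ 0) : eigenspace A μ = ⊥ := by
  rw [Submodule.eq_bot_iff]
  intro x hx
  obtain ⟨h, hx⟩ := mem_eigenspace_iff.1 hx
  by_contra hne
  have h1 := hA.posDef ⟨x, h⟩ (fun h0 => hne (congrArg Subtype.val h0))
  rw [hx, inner_smul_left, RCLike.conj_ofReal, RCLike.re_ofReal_mul, inner_self_eq_norm_sq] at h1
  nlinarith [sq_nonneg ‖x‖]

lemma isOrtho_eigenspace (hA : IsAdmissible A) {μ ν : ℝ} (hne : μ ≠ ν) :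
    eigenspace A μ ⟂ eigenspace A ν := by
  rw [Submodule.isOrtho_iff_inner_eq]
  intro x hx y hy
  obtain ⟨h1, hx⟩ := mem_eigenspace_iff.1 hx
  obtain ⟨h2, hy⟩ := mem_eigenspace_iff.1 hy
  have := inner_apply_left_of_isSelfAdjoint hA.selfAdjoint ⟨x, h1⟩ ⟨y, h2⟩
  rw [hx, hy, inner_smul_left, inner_smul_right, RCLike.conj_ofReal, ← sub_eq_zero, ← sub_mul,
    mul_eq_zero, sub_eq_zero] at this
  exact this.resolve_left fun h => hne (RCLike.ofReal_inj.1 h)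

/-- The spectral theorem for the compact symmetric operator `K`: its eigenvalues are real, and
nonzero because `K` is injective, so an eigenvector of `K` for `ν` is one of `A` for `ν⁻¹`. -/
lemma dense_iSup_eigenspace (hA : IsAdmissible A) (hK : IsBoundedInverse A K)
    (hKc : IsCompactOperator K) : Dense ((⨆ μ : ℝ, eigenspace A μ : Submodule 𝕜 H) : Set H) := by
  have hsym : (K : H →ₗ[𝕜] H).IsSymmetric := fun x y => inner_inverse_left hA hK x y
  have h1 := ContinuousLinearMap.orthogonalComplement_iSup_eigenspaces_eq_bot hKc hsym
  have h2 : (⨆ ν : 𝕜, Module.End.eigenspace (K : H →ₗ[𝕜] H) ν) ≤ ⨆ μ : ℝ, eigenspace A μ := by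
    refine iSup_le fun ν => ?_
    intro x hx
    by_cases hx0 : x = 0
    · rw [hx0]; exact Submodule.zero_mem _
    have hKx : K x = ν • x := Module.End.mem_eigenspace_iff.1 hx
    have hν : ν ≠ 0 := by
      rintro rfl
      rw [zero_smul] at hKx
      exact hx0 (hK.injective hKx)
    have hev : Module.End.HasEigenvalue (K : H →ₗ[𝕜] H) ν :=
      Module.End.hasEigenvalue_of_hasEigenvector ⟨hx, hx0⟩
    have hreal := RCLike.conj_eq_iff_re.1 (hsym.conj_eigenvalue_eq_self hev)
    refine Submodule.mem_iSup_of_mem (RCLike.re ν)⁻¹ (hK.mem_eigenspace_iff.2 ?_)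
    rw [hKx, RCLike.ofReal_inv, hreal, inv_smul_smul₀ hν]
  have h3 : (⨆ μ : ℝ, eigenspace A μ)ᗮ = ⊥ := by
    rw [eq_bot_iff, ← h1]
    exact Submodule.orthogonal_le h2
  rw [Submodule.dense_iff_topologicalClosure_eq_top]
  exact Submodule.topologicalClosure_eq_top_iff.2 h3

/-- The orthogonal projection onto (the closure of) an eigenspace. -/
noncomputable def spectralProj (A : H →ₗ.[𝕜] H) (μ : ℝ) : H →L[𝕜] H :=
  (eigenspace A μ).topologicalClosure.starProjection

lemma spectralProj_mem (hK : IsBoundedInverse A K) (μ : ℝ) (x : H) :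
    spectralProj A μ x ∈ eigenspace A μ := by
  rw [← hK.topologicalClosure_eigenspace μ]
  exact Submodule.starProjection_apply_mem _ x

lemma spectralProj_eq_zero (hA : IsAdmissible A) (hK : IsBoundedInverse A K) {μ : ℝ} (hμ : μ ≤ 0)
    (x : H) : spectralProj A μ x = 0 := by
  have := spectralProj_mem hK μ x
  rwa [eigenspace_eq_bot hA hμ, Submodule.mem_bot] at this

lemma spectralProj_of_mem {μ : ℝ} {x : H} (hx : x ∈ eigenspace A μ) : spectralProj A μ x = x :=
  Submodule.starProjection_eq_self_iff.2 (Submodule.le_topologicalClosure _ hx)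

lemma spectralProj_of_mem_of_ne (hA : IsAdmissible A) (hK : IsBoundedInverse A K) {μ ν : ℝ} {x : H}
    (hne : ν ≠ μ) (hx : x ∈ eigenspace A μ) : spectralProj A ν x = 0 := by
  refine (Submodule.starProjection_apply_eq_zero_iff _).2 ?_
  rw [hK.topologicalClosure_eigenspace]
  exact (isOrtho_eigenspace hA hne.symm) hx

lemma orthogonalFamily_eigenspace (hA : IsAdmissible A) :
    OrthogonalFamily 𝕜 (fun μ : ℝ => eigenspace A μ) fun μ => (eigenspace A μ).subtypeₗᵢ :=
  .of_pairwise fun _ _ h => isOrtho_eigenspace hA h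

lemma norm_sq_sum_spectralProj (hA : IsAdmissible A) (hK : IsBoundedInverse A K) (c : ℝ → ℝ) (x : H)
    (s : Finset ℝ) : ‖∑ μ ∈ s, ((c μ : ℝ) : 𝕜) • spectralProj A μ x‖ ^ 2 =
      ∑ μ ∈ s, (c μ) ^ 2 * ‖spectralProj A μ x‖ ^ 2 := by
  have := (orthogonalFamily_eigenspace hA).norm_sum
    (fun μ => ((c μ : ℝ) : 𝕜) • ⟨spectralProj A μ x, spectralProj_mem hK μ x⟩) s
  simpa [norm_smul, mul_pow] using this

/-- Bessel's inequality: the partial sum `y` satisfies `‖y‖² = re (x, y) ≤ ‖x‖ ‖y‖`. -/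
lemma sum_norm_sq_spectralProj_le (hA : IsAdmissible A) (hK : IsBoundedInverse A K) (x : H)
    (s : Finset ℝ) : ∑ μ ∈ s, ‖spectralProj A μ x‖ ^ 2 ≤ ‖x‖ ^ 2 := by
  set y := ∑ μ ∈ s, spectralProj A μ x with hy
  have h1 : ‖y‖ ^ 2 = ∑ μ ∈ s, ‖spectralProj A μ x‖ ^ 2 := by
    simpa using norm_sq_sum_spectralProj hA hK (fun _ => 1) x s
  have h2 : RCLike.re (inner 𝕜 x y) = ∑ μ ∈ s, ‖spectralProj A μ x‖ ^ 2 := by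
    rw [hy, inner_sum, map_sum]
    refine Finset.sum_congr rfl fun μ _ => ?_
    rw [← inner_conj_symm, RCLike.conj_re]
    exact Submodule.re_inner_starProjection_eq_normSq _ x
  have h3 : RCLike.re (inner 𝕜 x y) ≤ ‖x‖ * ‖y‖ := (RCLike.re_le_norm _).trans (norm_inner_le_norm x y)
  rw [h2, ← h1] at h3
  have h4 : ‖y‖ ≤ ‖x‖ := by
    rcases (norm_nonneg y).eq_or_lt with h | h
    · rw [← h]; exact norm_nonneg x
    · nlinarith
  rw [← h1]
  exact pow_le_pow_left₀ (norm_nonneg _) h4 2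

lemma norm_sum_spectralProj_le (hA : IsAdmissible A) (hK : IsBoundedInverse A K) {c : ℝ → ℝ} {C : ℝ}
    (hC : 0 ≤ C) (hc : ∀ μ, 0 < μ → |c μ| ≤ C) (x : H) (s : Finset ℝ) :
    ‖∑ μ ∈ s, ((c μ : ℝ) : 𝕜) • spectralProj A μ x‖ ≤ C * ‖x‖ := by
  refine le_of_sq_le_sq ?_ (by positivity)
  rw [norm_sq_sum_spectralProj hA hK, mul_pow]
  refine le_trans ?_ (mul_le_mul_of_nonneg_left (sum_norm_sq_spectralProj_le hA hK x s)
    (sq_nonneg C))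
  rw [Finset.mul_sum]
  refine Finset.sum_le_sum fun μ _ => ?_
  rcases le_or_gt μ 0 with h | h
  · simp [spectralProj_eq_zero hA hK h]
  · exact mul_le_mul_of_nonneg_right (sq_le_sq' (abs_le.1 (hc μ h)).1 (abs_le.1 (hc μ h)).2)
      (sq_nonneg _)

lemma summable_spectralProj (hA : IsAdmissible A) (hK : IsBoundedInverse A K) {c : ℝ → ℝ} {C : ℝ}
    (hc : ∀ μ, 0 < μ → |c μ| ≤ C) (x : H) :
    Summable fun μ => ((c μ : ℝ) : 𝕜) • spectralProj A μ x := by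
  have hC : 0 ≤ C := (abs_nonneg _).trans (hc 1 one_pos)
  have h := ((orthogonalFamily_eigenspace hA).summable_iff_norm_sq_summable
    (fun μ => ((c μ : ℝ) : 𝕜) • ⟨spectralProj A μ x, spectralProj_mem hK μ x⟩)).2 ?_
  · simpa using h
  · refine summable_of_sum_le (c := (C * ‖x‖) ^ 2) (fun _ => sq_nonneg _) fun s => ?_
    have h1 := norm_sum_spectralProj_le hA hK hC hc x s
    have h2 := norm_sq_sum_spectralProj hA hK c x s
    have h3 := pow_le_pow_left₀ (norm_nonneg _) h1 2
    rw [h2] at h3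
    simpa [norm_smul, mul_pow] using h3

/-- The function `c` of the operator `A`, where `c` is bounded on the positive numbers. -/
noncomputable def diag (hA : IsAdmissible A) (hK : IsBoundedInverse A K) (c : ℝ → ℝ) (C : ℝ)
    (hc : ∀ μ, 0 < μ → |c μ| ≤ C) : H →L[𝕜] H :=
  LinearMap.mkContinuous
    { toFun := fun x => ∑' μ, ((c μ : ℝ) : 𝕜) • spectralProj A μ x
      map_add' := fun x y => by
        simp only [map_add, smul_add]
        exact (summable_spectralProj hA hK hc x).tsum_add (summable_spectralProj hA hK hc y)
      map_smul' := fun r x => by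
        simp only [map_smul, RingHom.id_apply]
        rw [← (summable_spectralProj hA hK hc x).tsum_const_smul r]
        simp only [smul_comm r] } C
    fun x => le_of_tendsto (summable_spectralProj hA hK hc x).hasSum.norm
      (Filter.Eventually.of_forall fun s => norm_sum_spectralProj_le hA hK
        ((abs_nonneg _).trans (hc 1 one_pos)) hc x s)

lemma diag_apply (hA : IsAdmissible A) (hK : IsBoundedInverse A K) {c : ℝ → ℝ} {C : ℝ}
    (hc : ∀ μ, 0 < μ → |c μ| ≤ C) (x : H) :
    diag hA hK c C hc x = ∑' μ, ((c μ : ℝ) : 𝕜) • spectralProj A μ x := rfl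

lemma norm_diag_le (hA : IsAdmissible A) (hK : IsBoundedInverse A K) {c : ℝ → ℝ} {C : ℝ}
    (hc : ∀ μ, 0 < μ → |c μ| ≤ C) : ‖diag hA hK c C hc‖ ≤ C :=
  LinearMap.mkContinuous_norm_le _ ((abs_nonneg _).trans (hc 1 one_pos)) _

lemma norm_diag_sub_diag_le (hA : IsAdmissible A) (hK : IsBoundedInverse A K) {c c' : ℝ → ℝ}
    {C C' D : ℝ} (hc : ∀ μ, 0 < μ → |c μ| ≤ C) (hc' : ∀ μ, 0 < μ → |c' μ| ≤ C')
    (hD : ∀ μ, 0 < μ → |c μ - c' μ| ≤ D) :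
    ‖diag hA hK c C hc - diag hA hK c' C' hc'‖ ≤ D := by
  have : diag hA hK c C hc - diag hA hK c' C' hc' = diag hA hK (fun μ => c μ - c' μ) D hD := by
    ext x
    rw [sub_apply, diag_apply, diag_apply, diag_apply,
      ← (summable_spectralProj hA hK hc x).tsum_sub (summable_spectralProj hA hK hc' x)]
    simp only [RCLike.ofReal_sub, sub_smul]
  rw [this]
  exact norm_diag_le hA hK hD

lemma diag_of_mem (hA : IsAdmissible A) (hK : IsBoundedInverse A K) {c : ℝ → ℝ} {C : ℝ}
    (hc : ∀ μ, 0 < μ → |c μ| ≤ C) {μ : ℝ} {x : H} (hx : x ∈ eigenspace A μ) :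
    diag hA hK c C hc x = ((c μ : ℝ) : 𝕜) • x := by
  rw [diag_apply, tsum_eq_single μ fun ν hν => by
    rw [spectralProj_of_mem_of_ne hA hK hν hx, smul_zero], spectralProj_of_mem hx]

variable [NormedSpace ℝ H] [IsScalarTower ℝ 𝕜 H]

lemma norm_restrictScalars_diag_sub_le (hA : IsAdmissible A) (hK : IsBoundedInverse A K)
    {c c' : ℝ → ℝ} {C C' D : ℝ} (hc : ∀ μ, 0 < μ → |c μ| ≤ C) (hc' : ∀ μ, 0 < μ → |c' μ| ≤ C')
    (hD : ∀ μ, 0 < μ → |c μ - c' μ| ≤ D) :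
    ‖(diag hA hK c C hc).restrictScalars ℝ - (diag hA hK c' C' hc').restrictScalars ℝ‖ ≤ D :=
  (ContinuousLinearMap.norm_restrictScalars (𝕜' := ℝ)
    (diag hA hK c C hc - diag hA hK c' C' hc')).le.trans (norm_diag_sub_diag_le hA hK hc hc' hD)

/-- Eigenvectors with positive eigenvalue span a dense subspace. This reduces the operator
identities of a smoothing family to scalar identities for `exp(-tμ)`. -/
lemma ext_eigenspace (hA : IsAdmissible A) (hK : IsBoundedInverse A K) (hKc : IsCompactOperator K)
    {f g : H →L[ℝ] H} (h : ∀ μ, 0 < μ → ∀ x ∈ eigenspace A μ, f x = g x) : f = g := by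
  refine DFunLike.coe_injective (f.continuous.ext_on (dense_iSup_eigenspace hA hK hKc) g.continuous
    fun x hx => ?_)
  refine Submodule.iSup_induction _ (motive := fun x => f x = g x) hx (fun μ x hx => ?_)
    (by simp) fun x y hx hy => by rw [map_add, map_add, hx, hy]
  rcases le_or_gt μ 0 with h0 | h0
  · rw [eigenspace_eq_bot hA h0, Submodule.mem_bot] at hx
    simp [hx]
  · exact h μ h0 x hx

lemma inverse_of_mem (hK : IsBoundedInverse A K) {μ : ℝ} (hμ : 0 < μ) {x : H}
    (hx : x ∈ eigenspace A μ) : K x = μ⁻¹ • x := by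
  have := hK.mem_eigenspace_iff.1 hx
  conv_rhs => rw [this, ← RCLike.real_smul_eq_coe_smul (K := 𝕜)]
  rw [inv_smul_smul₀ hμ.ne']

lemma abs_exp_le {t : ℝ} (ht : 0 ≤ t) : ∀ μ : ℝ, 0 < μ → |Real.exp (-(t * μ))| ≤ 1 := by
  intro μ hμ
  rw [abs_of_pos (Real.exp_pos _), Real.exp_le_one_iff]
  nlinarith [mul_nonneg ht hμ.le]

lemma abs_mul_exp_le {t : ℝ} (ht : 0 < t) :
    ∀ μ : ℝ, 0 < μ → |μ * Real.exp (-(t * μ))| ≤ t⁻¹ := by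
  intro μ hμ
  rw [abs_of_pos (by positivity), Real.exp_neg, ← div_eq_mul_inv, div_le_iff₀ (Real.exp_pos _),
    ← div_eq_inv_mul, le_div_iff₀ ht]
  nlinarith [Real.add_one_le_exp (t * μ)]

/-- The retained decay `exp(-rμ)` makes the Lipschitz constant bounded uniformly in `μ`, whence
continuity in operator norm away from `t = 0`. -/
lemma abs_exp_sub_exp_le {r s t μ : ℝ} (hμ : 0 < μ) (hs : r ≤ s) (ht : r ≤ t) :
    |Real.exp (-(t * μ)) - Real.exp (-(s * μ))| ≤ μ * Real.exp (-(r * μ)) * |t - s| := by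
  wlog hst : s ≤ t generalizing s t
  · rw [abs_sub_comm, abs_sub_comm t]
    exact this ht hs (le_of_not_ge hst)
  have h1 : Real.exp (-(t * μ)) = Real.exp (-(s * μ)) * Real.exp (-((t - s) * μ)) := by
    rw [← Real.exp_add]; ring_nf
  have h2 := Real.add_one_le_exp (-((t - s) * μ))
  have h3 : Real.exp (-(s * μ)) ≤ Real.exp (-(r * μ)) :=
    Real.exp_le_exp.2 (by nlinarith)
  have h4 : Real.exp (-(t * μ)) ≤ Real.exp (-(s * μ)) := Real.exp_le_exp.2 (by nlinarith)
  rw [abs_sub_comm, abs_of_nonneg (by linarith), abs_of_nonneg (by linarith : (0 : ℝ) ≤ t - s), h1]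
  have h5 := Real.exp_pos (-(s * μ))
  have h6 : 0 ≤ (t - s) * μ := mul_nonneg (by linarith) hμ.le
  calc _ = Real.exp (-(s * μ)) * (1 - Real.exp (-((t - s) * μ))) := by ring
    _ ≤ Real.exp (-(s * μ)) * ((t - s) * μ) := by gcongr; linarith
    _ ≤ Real.exp (-(r * μ)) * ((t - s) * μ) := by gcongr
    _ = _ := by ring

lemma sq_mul_exp_le {r μ : ℝ} (hr : 0 < r) (hμ : 0 < μ) :
    μ * (μ * Real.exp (-(r * μ))) ≤ (r / 2)⁻¹ * (r / 2)⁻¹ := by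
  have h := abs_mul_exp_le (half_pos hr) μ hμ
  rw [abs_of_pos (by positivity)] at h
  calc _ = (μ * Real.exp (-(r / 2 * μ))) * (μ * Real.exp (-(r / 2 * μ))) := by
        have : Real.exp (-(r * μ)) = Real.exp (-(r / 2 * μ)) * Real.exp (-(r / 2 * μ)) := by
          rw [← Real.exp_add]; ring_nf
        rw [this]; ring
    _ ≤ _ := mul_le_mul h h (by positivity) (by positivity)

open Classical in
/-- `exp(-tA)` for `t > 0`, as a bounded real-linear operator. -/
noncomputable def expOp (hA : IsAdmissible A) (hK : IsBoundedInverse A K) (t : ℝ) : H →L[ℝ] H :=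
  if ht : 0 < t then
    (diag hA hK (fun μ => Real.exp (-(t * μ))) 1 (abs_exp_le ht.le)).restrictScalars ℝ else 0

open Classical in
/-- `A exp(-tA)` for `t > 0`, as a bounded real-linear operator. -/
noncomputable def genExpOp (hA : IsAdmissible A) (hK : IsBoundedInverse A K) (t : ℝ) : H →L[ℝ] H :=
  if ht : 0 < t then
    (diag hA hK (fun μ => μ * Real.exp (-(t * μ))) t⁻¹ (abs_mul_exp_le ht)).restrictScalars ℝ else 0

lemma expOp_of_mem (hA : IsAdmissible A) (hK : IsBoundedInverse A K) {t : ℝ} (ht : 0 < t) {μ : ℝ}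
    {x : H} (hx : x ∈ eigenspace A μ) : expOp hA hK t x = Real.exp (-(t * μ)) • x := by
  rw [expOp, dif_pos ht, ContinuousLinearMap.coe_restrictScalars', diag_of_mem hA hK _ hx,
    RCLike.real_smul_eq_coe_smul (K := 𝕜)]

lemma genExpOp_of_mem (hA : IsAdmissible A) (hK : IsBoundedInverse A K) {t : ℝ} (ht : 0 < t)
    {μ : ℝ} {x : H} (hx : x ∈ eigenspace A μ) :
    genExpOp hA hK t x = (μ * Real.exp (-(t * μ))) • x := by
  rw [genExpOp, dif_pos ht, ContinuousLinearMap.coe_restrictScalars', diag_of_mem hA hK _ hx,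
    RCLike.real_smul_eq_coe_smul (K := 𝕜)]

lemma semigroup_eq_expOp (hA : IsAdmissible A) (hK : IsBoundedInverse A K) {t : ℝ} (ht : 0 < t)
    (x : H) : semigroup A t x = expOp hA hK t x := by
  rw [expOp, dif_pos ht]; rfl

lemma continuousOn_of_locally_lipschitz {F : ℝ → H →L[ℝ] H} {D : ℝ → ℝ}
    (h : ∀ r, 0 < r → ∀ s t, r ≤ s → r ≤ t → ‖F t - F s‖ ≤ D r * |t - s|) :
    ContinuousOn F (Ioi 0) := by
  intro s hs
  have hs' : 0 < s / 2 := half_pos hs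
  refine ContinuousAt.continuousWithinAt ?_
  rw [ContinuousAt, tendsto_iff_norm_sub_tendsto_zero]
  have hlim : Filter.Tendsto (fun t => D (s / 2) * |t - s|) (nhds s) (nhds 0) := by
    have : Continuous fun t : ℝ => D (s / 2) * |t - s| := by fun_prop
    simpa using this.tendsto s
  refine squeeze_zero' (Filter.Eventually.of_forall fun _ => norm_nonneg _) ?_ hlim
  filter_upwards [Ioi_mem_nhds (half_lt_self hs)] with t ht
  exact h _ hs' s t (half_le_self hs.le) (le_of_lt ht)

lemma continuousOn_expOp (hA : IsAdmissible A) (hK : IsBoundedInverse A K) :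
    ContinuousOn (expOp hA hK) (Ioi 0) := by
  refine continuousOn_of_locally_lipschitz (D := fun r => r⁻¹) fun r hr s t hs ht => ?_
  rw [expOp, expOp, dif_pos (hr.trans_le hs), dif_pos (hr.trans_le ht)]
  refine norm_restrictScalars_diag_sub_le hA hK _ _ fun μ hμ => ?_
  refine (abs_exp_sub_exp_le hμ hs ht).trans (mul_le_mul_of_nonneg_right ?_ (abs_nonneg _))
  exact (le_abs_self _).trans (abs_mul_exp_le hr μ hμ)

lemma continuousOn_genExpOp (hA : IsAdmissible A) (hK : IsBoundedInverse A K) :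
    ContinuousOn (genExpOp hA hK) (Ioi 0) := by
  refine continuousOn_of_locally_lipschitz (D := fun r => (r / 2)⁻¹ * (r / 2)⁻¹)
    fun r hr s t hs ht => ?_
  rw [genExpOp, genExpOp, dif_pos (hr.trans_le hs), dif_pos (hr.trans_le ht)]
  refine norm_restrictScalars_diag_sub_le hA hK _ _ fun μ hμ => ?_
  rw [← mul_sub, abs_mul, abs_of_pos hμ]
  calc _ ≤ μ * (μ * Real.exp (-(r * μ)) * |t - s|) :=
        mul_le_mul_of_nonneg_left (abs_exp_sub_exp_le hμ hs ht) hμ.le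
    _ = μ * (μ * Real.exp (-(r * μ))) * |t - s| := by ring
    _ ≤ _ := mul_le_mul_of_nonneg_right (sq_mul_exp_le hr hμ) (abs_nonneg _)

lemma norm_expOp_le (hA : IsAdmissible A) (hK : IsBoundedInverse A K) {t : ℝ} (ht : 0 < t) :
    ‖expOp hA hK t‖ ≤ 1 := by
  rw [expOp, dif_pos ht, ContinuousLinearMap.norm_restrictScalars]
  exact norm_diag_le hA hK _

lemma integral_exp_neg_mul {t μ : ℝ} (hμ : 0 < μ) :
    ∫ s in (0 : ℝ)..t, Real.exp (-(s * μ)) = μ⁻¹ * (1 - Real.exp (-(t * μ))) := by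
  have h : ∀ s ∈ uIcc 0 t, HasDerivAt (fun s => -(μ⁻¹ * Real.exp (-(s * μ))))
      (Real.exp (-(s * μ))) s := by
    intro s _
    have h1 : HasDerivAt (fun s => -(s * μ)) (-(1 * μ)) s := ((hasDerivAt_id s).mul_const μ).neg
    refine (h1.exp.const_mul μ⁻¹).neg.congr_deriv ?_
    field_simp
  have hc : Continuous fun s => Real.exp (-(s * μ)) := by fun_prop
  rw [intervalIntegral.integral_eq_sub_of_hasDerivAt h (hc.intervalIntegrable _ _)]
  simp
  ring

theorem smoothingFamily (hA : IsAdmissible A) (hK : IsBoundedInverse A K)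
    (hKc : IsCompactOperator K) :
    SmoothingFamily (K.restrictScalars ℝ) (expOp hA hK) (genExpOp hA hK) where
  cont_E := continuousOn_expOp hA hK
  cont_G := continuousOn_genExpOp hA hK
  norm_E t ht := norm_expOp_le hA hK ht
  norm_G t ht := by
    rw [genExpOp, dif_pos ht, ContinuousLinearMap.norm_restrictScalars]
    exact norm_diag_le hA hK _
  apply_G t ht y := by
    have : (K.restrictScalars ℝ).comp (genExpOp hA hK t) = expOp hA hK t := by
      refine ext_eigenspace hA hK hKc fun μ hμ x hx => ?_
      rw [ContinuousLinearMap.comp_apply, genExpOp_of_mem hA hK ht hx, expOp_of_mem hA hK ht hx,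
        map_smul, ContinuousLinearMap.coe_restrictScalars', inverse_of_mem hK hμ hx, smul_smul]
      congr 1
      field_simp
    exact congrArg (fun L => L y) this
  comm t ht y := by
    have : (K.restrictScalars ℝ).comp (expOp hA hK t) =
        (expOp hA hK t).comp (K.restrictScalars ℝ) := by
      refine ext_eigenspace hA hK hKc fun μ hμ x hx => ?_
      rw [ContinuousLinearMap.comp_apply, ContinuousLinearMap.comp_apply, expOp_of_mem hA hK ht hx,
        map_smul, ContinuousLinearMap.coe_restrictScalars', inverse_of_mem hK hμ hx, map_smul,
        expOp_of_mem hA hK ht hx, smul_comm]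
    exact congrArg (fun L => L y) this
  integral_E t ht y := by
    have hE : IntervalIntegrable (expOp hA hK) volume 0 t :=
      (WeaklySingular.of_bounded le_rfl ((continuousOn_expOp hA hK).mono
        fun x (hx : x ∈ Ioc 0 t) => hx.1) zero_le_one
        fun s hs => norm_expOp_le hA hK hs.1).intervalIntegrable one_pos ht.le le_rfl
    have : ∫ s in (0 : ℝ)..t, expOp hA hK s =
        (K.restrictScalars ℝ).comp (ContinuousLinearMap.id ℝ H - expOp hA hK t) := by
      refine ext_eigenspace hA hK hKc fun μ hμ x hx => ?_
      rw [ContinuousLinearMap.intervalIntegral_apply hE,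
        SmoothingFamily.integral_congr_Ioc
          (fun s hs => expOp_of_mem hA hK hs.1 hx) (right_mem_Ioc.2 ht),
        intervalIntegral.integral_smul_const, integral_exp_neg_mul hμ,
        ContinuousLinearMap.comp_apply, sub_apply, expOp_of_mem hA hK ht hx,
        ContinuousLinearMap.id_apply, map_sub, map_smul, ContinuousLinearMap.coe_restrictScalars',
        inverse_of_mem hK hμ hx, smul_smul, ← sub_smul]
      congr 1
      ring
    rw [← ContinuousLinearMap.intervalIntegral_apply hE, this]
    rfl
  injective y hy := hK.injective hy

end Spectral

/-- `E' = -G`. -/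
lemma SmoothingFamily.hasDerivAt_E {Y : Type*} [NormedAddCommGroup Y] [NormedSpace ℝ Y]
    [CompleteSpace Y] {K : Y →L[ℝ] Y} {E G : ℝ → Y →L[ℝ] Y} (S : SmoothingFamily K E G) (y : Y)
    {t : ℝ} (ht : 0 < t) : HasDerivAt (fun s => E s y) (-G t y) t := by
  have hG : ContinuousOn (fun s => G s y) (Ioi 0) := S.cont_G.clm_apply continuousOn_const
  have hint : ∀ s, 0 < s → IntervalIntegrable (fun s => G s y) volume t s := fun s hs =>
    (hG.mono fun x hx => (lt_min ht hs).trans_le hx.1).intervalIntegrable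
  have hE : ∀ s, 0 < s → IntervalIntegrable (fun s => E s y) volume 0 s := fun s hs =>
    ((S.weaklySingular_E (T := s) le_rfl).clm_apply
      (ContinuousLinearMap.apply ℝ Y y)).intervalIntegrable one_pos hs.le le_rfl
  -- Starting the integral at `t > 0` avoids the singularity of `G` at `0`; after applying the
  -- injective `K` the identity is a difference of two instances of `integral_E`.
  have key : ∀ s, 0 < s → E s y = E t y - ∫ r in t..s, G r y := by
    intro s hs
    rw [← sub_eq_zero]
    refine S.injective _ ?_
    have h1 : ∫ r in t..s, K (G r y) = ∫ r in t..s, E r y :=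
      intervalIntegral.integral_congr fun r hr => S.apply_G r ((lt_min ht hs).trans_le hr.1) y
    have h2 := S.integral_E s hs y
    rw [← intervalIntegral.integral_add_adjacent_intervals (hE t ht)
      ((hE t ht).symm.trans (hE s hs)), S.integral_E t ht, map_sub, map_sub] at h2
    rw [map_sub, map_sub, ← ContinuousLinearMap.intervalIntegral_comp_comm _ (hint s hs), h1,
      eq_sub_of_add_eq' h2]
    abel
  have hd := intervalIntegral.integral_hasDerivAt_right (hint t ht)
    (hG.stronglyMeasurableAtFilter isOpen_Ioi t ht) (hG.continuousAt (Ioi_mem_nhds ht))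
  refine (hd.const_sub (E t y)).congr_of_eventuallyEq ?_
  filter_upwards [Ioi_mem_nhds ht] with s hs using key s hs

end TemperedVolterra

/-! ### Dominated operators, tempered kernels and data. -/

namespace TemperedVolterra

section Domination

variable {𝕜 H : Type*} [RCLike 𝕜] [NormedAddCommGroup H] [InnerProductSpace 𝕜 H]
  {A B : H →ₗ.[𝕜] H} {K : H →L[𝕜] H}

lemma scaleNorm_two (x : H) : scaleNorm A 2 x = ‖app A x‖ := by
  rw [norm_eq_sqrt_re_inner (𝕜 := 𝕜)]
  rfl

lemma scaleNorm_zero (x : H) : scaleNorm A 0 x = ‖x‖ := by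
  rw [norm_eq_sqrt_re_inner (𝕜 := 𝕜)]
  rfl

variable [CompleteSpace H]

/-- Domination with `ϑ = 0`, `q = 2` extends from the dense `D(A)` to all `v` by continuity; then
take `v = B w`. -/
lemma Dominates.exists_norm_le (hA : IsAdmissible A) (hAB : Dominates A B) :
    ∃ C : ℝ, ∀ w ∈ A.domain, ‖app B w‖ ≤ C * ‖app A w‖ := by
  obtain ⟨C, hC⟩ := hAB.2
  refine ⟨C, fun w hw => ?_⟩
  have key : ∀ v : H, ‖inner 𝕜 (app B w) v‖ ≤ C * ‖app A w‖ * ‖v‖ := by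
    intro v
    refine hA.selfAdjoint.dense_domain.induction (P := fun v =>
      ‖inner 𝕜 (app B w) v‖ ≤ C * ‖app A w‖ * ‖v‖) (fun v hv => ?_)
      (isClosed_le (by fun_prop) (by fun_prop)) v
    have := hC w hw v hv 0 2 rfl
    rwa [scaleNorm_two, scaleNorm_zero] at this
  -- The sign of `C` is not known, so `B w = 0` needs its own argument.
  rcases (norm_nonneg (app B w)).eq_or_lt with h | h
  · obtain h0 | h0 := eq_or_ne w 0
    · subst h0
      have h1 : app A (0 : H) = 0 := by
        rw [app_of_mem hw]; exact LinearPMap.map_zero A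
      rw [← h, h1, norm_zero, mul_zero]
    · have := (norm_nonneg _).trans (key w)
      rw [← h]
      exact nonneg_of_mul_nonneg_left this (norm_pos_iff.2 h0)
  · have := key (app B w)
    rw [inner_self_eq_norm_sq_to_K, norm_pow, RCLike.norm_ofReal, abs_of_pos h, sq] at this
    exact le_of_mul_le_mul_right this h

/-- Here `M = B A⁻¹` is bounded by domination, and by self-adjointness of `A` and `B` its adjoint
extends `A⁻¹ B` to the whole space. Thus `A⁻¹ B u` is controlled by `u` alone, with no information
on `A u`. -/
lemma Dominates.exists_bounded (hA : IsAdmissible A) (hK : IsBoundedInverse A K)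
    (hB : IsSelfAdjoint B) (hAB : Dominates A B) :
    ∃ M L : H →L[𝕜] H, (∀ y, M y = app B (K y)) ∧ ∀ w ∈ A.domain, K (app B w) = L w := by
  obtain ⟨C, hC⟩ := hAB.exists_norm_le hA
  have hmem : ∀ y, K y ∈ B.domain := fun y => hAB.1 (hK.mem_domain y)
  let M : H →L[𝕜] H := LinearMap.mkContinuous
    (B.toFun.comp ((K : H →ₗ[𝕜] H).codRestrict B.domain hmem)) C fun y => by
      have := hC _ (hK.mem_domain y)
      rwa [hK.app_apply, app_of_mem (hmem y)] at this
  have hM : ∀ y, M y = app B (K y) := fun y => (app_of_mem (hmem y)).symm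
  refine ⟨M, ContinuousLinearMap.adjoint M, hM, fun w hw => ?_⟩
  refine ext_inner_right 𝕜 fun v => ?_
  rw [ContinuousLinearMap.adjoint_inner_left, inner_inverse_left hA hK, hM,
    app_of_mem (hAB.1 hw), app_of_mem (hmem v)]
  exact inner_apply_left_of_isSelfAdjoint hB ⟨w, hAB.1 hw⟩ ⟨K v, hmem v⟩

end Domination

section Kernel

lemma hasDerivAt_kernel (κ a : ℝ) {t : ℝ} (ht : 0 < t) :
    HasDerivAt (kernel κ a)
      (Real.exp (-κ * t) * (-κ * t ^ (a - 1) + (a - 1) * t ^ (a - 2)) / Real.Gamma a) t := by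
  have h1 : HasDerivAt (fun t => Real.exp (-κ * t)) (Real.exp (-κ * t) * (-κ * 1)) t :=
    ((hasDerivAt_id t).const_mul (-κ)).exp
  have h2 : HasDerivAt (fun t : ℝ => t ^ (a - 1)) ((a - 1) * t ^ (a - 1 - 1)) t :=
    Real.hasDerivAt_rpow_const (Or.inl ht.ne')
  refine ((h1.mul h2).div_const _).congr_deriv ?_
  rw [show a - 1 - 1 = a - 2 by ring]
  ring

lemma exp_neg_mul_le_one {κ t : ℝ} (hκ : 0 ≤ κ) (ht : 0 ≤ t) : Real.exp (-κ * t) ≤ 1 := by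
  rw [Real.exp_le_one_iff]
  nlinarith [mul_nonneg hκ ht]

lemma rpow_sub_one_eq {α t : ℝ} (ht : 0 < t) : t ^ (α - 1) = t * t ^ (α - 2) := by
  rw [mul_comm, ← Real.rpow_add_one ht.ne']
  ring_nf

/-- The factor `T^{a-α}` lowers the exponent to the `α` shared by all kernels. In the derivative, `κ
t^{a-1} ≤ κT t^{a-2}` and `|a - 1| ≤ 1` account for `1 + κT`. -/
lemma lipschitzSingular_kernel {κ a α T : ℝ} (hκ : 0 ≤ κ) (hα : 0 < α) (hαa : α ≤ a) (ha : a < 1) :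
    LipschitzSingular α T ((1 + κ * T) * T ^ (a - α) / Real.Gamma a) (kernel κ a) := by
  have hΓ : 0 < Real.Gamma a := Real.Gamma_pos_of_pos (hα.trans_le hαa)
  have hrpow : ∀ t ∈ Ioc 0 T, ∀ p, t ^ (a - p) ≤ T ^ (a - α) * t ^ (α - p) := by
    intro t ht p
    rw [show a - p = (a - α) + (α - p) by ring, Real.rpow_add ht.1]
    exact mul_le_mul_of_nonneg_right (Real.rpow_le_rpow ht.1.le ht.2 (by linarith))
      (Real.rpow_nonneg ht.1.le _)
  rcases le_or_gt T 0 with hT | hT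
  · exact ⟨fun t ht => absurd (ht.1.trans_le ht.2) (not_lt.2 hT),
      fun s t h0 h1 h2 => absurd (h0.trans_le (h1.trans h2)) (not_lt.2 hT)⟩
  refine .of_deriv (by linarith) (by positivity) (fun t ht => ?_)
    (fun t ht => (hasDerivAt_kernel κ a ht.1).hasDerivWithinAt) fun t ht => ?_
  · have p1 := Real.rpow_nonneg ht.1.le (a - 1)
    have p2 := Real.rpow_nonneg ht.1.le (α - 1)
    rw [kernel, Real.norm_of_nonneg (by positivity), div_mul_eq_mul_div]
    refine div_le_div_of_nonneg_right ?_ hΓ.le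
    calc Real.exp (-κ * t) * t ^ (a - 1) ≤ 1 * (T ^ (a - α) * t ^ (α - 1)) :=
          mul_le_mul (exp_neg_mul_le_one hκ ht.1.le) (hrpow t ht 1) p1 zero_le_one
      _ ≤ (1 + κ * T) * (T ^ (a - α) * t ^ (α - 1)) :=
          mul_le_mul_of_nonneg_right (by nlinarith [mul_nonneg hκ hT.le]) (by positivity)
      _ = _ := by ring
  · have p1 := Real.rpow_nonneg ht.1.le (a - 2)
    have p2 := Real.rpow_nonneg ht.1.le (α - 2)
    rw [norm_div, norm_mul, Real.norm_of_nonneg hΓ.le, Real.norm_of_nonneg (Real.exp_pos _).le,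
      div_mul_eq_mul_div]
    refine div_le_div_of_nonneg_right ?_ hΓ.le
    have h1 : ‖-κ * t ^ (a - 1) + (a - 1) * t ^ (a - 2)‖ ≤ (1 + κ * T) * t ^ (a - 2) := by
      rw [rpow_sub_one_eq ht.1, ← mul_assoc, ← add_mul, norm_mul, Real.norm_of_nonneg p1]
      refine mul_le_mul_of_nonneg_right ?_ p1
      rw [Real.norm_eq_abs, abs_le]
      have := mul_le_mul_of_nonneg_left ht.2 hκ
      have := mul_nonneg hκ ht.1.le
      constructor <;> linarith
    calc _ ≤ 1 * ((1 + κ * T) * t ^ (a - 2)) :=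
          mul_le_mul (exp_neg_mul_le_one hκ ht.1.le) h1 (norm_nonneg _) zero_le_one
      _ ≤ (1 + κ * T) * (T ^ (a - α) * t ^ (α - 2)) := by
          rw [one_mul]
          exact mul_le_mul_of_nonneg_left (hrpow t ht 2) (by positivity)
      _ = _ := by ring

/-- The operator kernel `∑_j β_j(t) M_j`. -/
noncomputable def operatorKernel {Y : Type*} [NormedAddCommGroup Y] [NormedSpace ℝ Y] {m : ℕ}
    (κ : ℝ) (α : Fin m → ℝ) (M : Fin m → Y →L[ℝ] Y) (t : ℝ) : Y →L[ℝ] Y :=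
  ∑ j, kernel κ (α j) t • M j

lemma exists_lipschitzSingular_operatorKernel {Y : Type*} [NormedAddCommGroup Y] [NormedSpace ℝ Y]
    {m : ℕ} {κ a : ℝ} (T : ℝ) {α : Fin m → ℝ} (M : Fin m → Y →L[ℝ] Y) (hκ : 0 ≤ κ) (ha : 0 < a)
    (hα : ∀ j, a ≤ α j ∧ α j < 1) :
    ∃ c, LipschitzSingular a T c (operatorKernel κ α M) :=
  ⟨_, .sum fun j _ => (lipschitzSingular_kernel hκ ha (hα j).1 (hα j).2).clm_apply
    (ContinuousLinearMap.toSpanSingleton ℝ (M j))⟩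

end Kernel

section Data

variable {H : Type*} [NormedAddCommGroup H] [NormedSpace ℝ H]

/-- Removing the exponential weight from the data. -/
lemma lipschitzSingular_exp_smul {α κ T M : ℝ} {g g' g'' : ℝ → H} (hα1 : α ≤ 1) (hκ : 0 ≤ κ)
    (hT : 0 < T) (hM : 0 ≤ M)
    (hg : ∀ t ∈ Ioc 0 T, HasDerivWithinAt g (g' t) (Ioc 0 T) t)
    (hg' : ∀ t ∈ Ioc 0 T, HasDerivWithinAt g' (g'' t) (Ioc 0 T) t)
    (hb : ∀ t ∈ Ioc 0 T, ‖g t‖ ≤ M) (hb' : ∀ t ∈ Ioc 0 T, ‖g' t‖ ≤ M * t ^ (α - 1))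
    (hb'' : ∀ t ∈ Ioc 0 T, t * ‖g'' t‖ ≤ M * t ^ (α - 1)) :
    LipschitzSingular α T (M * (1 + 2 * κ * T + κ * T ^ (1 - α) + κ ^ 2 * (T * T ^ (1 - α))))
      (fun t => Real.exp (-κ * t) • (g' t - κ • g t)) := by
  have hTα := Real.rpow_nonneg hT.le (1 - α)
  -- The size bound needs `1 + κ T^{1-α}` and the derivative bound `1 + 2κT + κ² T T^{1-α}`; the
  -- stated constant covers both.
  refine .of_deriv (φ' := fun t => Real.exp (-κ * t) • (g'' t - κ • g' t) +
    (Real.exp (-κ * t) * (-κ * 1)) • (g' t - κ • g t)) (by linarith) (by positivity)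
    (fun t ht => ?_) (fun t ht => ?_) fun t ht => ?_
  · have p := Real.rpow_nonneg ht.1.le (α - 1)
    have h1 := WeaklySingular.one_le_rpow hα1 ht
    have h2 : ‖g' t - κ • g t‖ ≤ M * t ^ (α - 1) + κ * M := by
      refine (norm_sub_le _ _).trans (add_le_add (hb' t ht) ?_)
      rw [norm_smul, Real.norm_of_nonneg hκ]
      exact mul_le_mul_of_nonneg_left (hb t ht) hκ
    rw [norm_smul, Real.norm_of_nonneg (Real.exp_pos _).le]
    calc _ ≤ 1 * (M * t ^ (α - 1) + κ * M) :=
          mul_le_mul (exp_neg_mul_le_one hκ ht.1.le) h2 (norm_nonneg _) zero_le_one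
      _ ≤ M * t ^ (α - 1) + κ * M * (T ^ (1 - α) * t ^ (α - 1)) := by
          rw [one_mul]
          exact add_le_add le_rfl (le_mul_of_one_le_right (by positivity) h1)
      _ = M * (1 + κ * T ^ (1 - α)) * t ^ (α - 1) := by ring
      _ ≤ _ := by
          refine mul_le_mul_of_nonneg_right (mul_le_mul_of_nonneg_left ?_ hM) p
          have : 0 ≤ 2 * κ * T := by positivity
          have : 0 ≤ κ ^ 2 * (T * T ^ (1 - α)) := by positivity
          linarith
  · have h1 : HasDerivAt (fun t => Real.exp (-κ * t)) (Real.exp (-κ * t) * (-κ * 1)) t :=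
      ((hasDerivAt_id t).const_mul (-κ)).exp
    exact h1.hasDerivWithinAt.smul ((hg' t ht).sub ((hg t ht).const_smul κ))
  · have p := Real.rpow_nonneg ht.1.le (α - 2)
    have p1 := Real.rpow_nonneg ht.1.le (α - 1)
    have h0 : t ^ (α - 1) ≤ T * t ^ (α - 2) := by
      rw [rpow_sub_one_eq ht.1]; exact mul_le_mul_of_nonneg_right ht.2 p
    have h1 : 1 ≤ T * T ^ (1 - α) * t ^ (α - 2) :=
      (WeaklySingular.one_le_rpow hα1 ht).trans ((mul_le_mul_of_nonneg_left h0 hTα).trans_eq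
        (by ring))
    have h2 : ‖g'' t‖ ≤ M * t ^ (α - 2) := by
      have := hb'' t ht
      rw [rpow_sub_one_eq ht.1, mul_left_comm] at this
      exact le_of_mul_le_mul_left this ht.1
    have h3 : ‖g' t‖ ≤ M * (T * t ^ (α - 2)) :=
      (hb' t ht).trans (mul_le_mul_of_nonneg_left h0 hM)
    have h4 : ‖g t‖ ≤ M * (T * T ^ (1 - α) * t ^ (α - 2)) :=
      (hb t ht).trans (le_mul_of_one_le_right hM h1)
    have h5 : ‖g'' t - κ • g' t‖ ≤ M * t ^ (α - 2) + κ * (M * (T * t ^ (α - 2))) := by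
      refine (norm_sub_le _ _).trans (add_le_add h2 ?_)
      rw [norm_smul, Real.norm_of_nonneg hκ]
      exact mul_le_mul_of_nonneg_left h3 hκ
    have h6 : ‖g' t - κ • g t‖ ≤
        M * (T * t ^ (α - 2)) + κ * (M * (T * T ^ (1 - α) * t ^ (α - 2))) := by
      refine (norm_sub_le _ _).trans (add_le_add h3 ?_)
      rw [norm_smul, Real.norm_of_nonneg hκ]
      exact mul_le_mul_of_nonneg_left h4 hκ
    have he := exp_neg_mul_le_one hκ ht.1.le
    have he0 := (Real.exp_pos (-κ * t)).le
    have h7 : ‖Real.exp (-κ * t) * (-κ * 1)‖ ≤ κ := by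
      rw [mul_one, norm_mul, norm_neg, Real.norm_of_nonneg he0, Real.norm_of_nonneg hκ]
      exact mul_le_of_le_one_left hκ he
    calc _ ≤ 1 * (M * t ^ (α - 2) + κ * (M * (T * t ^ (α - 2)))) +
          κ * (M * (T * t ^ (α - 2)) + κ * (M * (T * T ^ (1 - α) * t ^ (α - 2)))) := by
          refine (norm_add_le _ _).trans (add_le_add ?_ ?_)
          · rw [norm_smul, Real.norm_of_nonneg he0]
            exact mul_le_mul he h5 (norm_nonneg _) zero_le_one
          · rw [norm_smul]
            exact mul_le_mul h7 h6 (norm_nonneg _) hκ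
      _ = M * (1 + 2 * κ * T + κ ^ 2 * (T * T ^ (1 - α))) * t ^ (α - 2) := by ring
      _ ≤ _ := by
          refine mul_le_mul_of_nonneg_right (mul_le_mul_of_nonneg_left ?_ hM) p
          have : 0 ≤ κ * T ^ (1 - α) := by positivity
          linarith

end Data

/-! ### Classical solutions satisfy the integrated equation. -/

section Solution

variable {𝕜 H : Type*} [RCLike 𝕜] [NormedAddCommGroup H] [InnerProductSpace 𝕜 H]
  [CompleteSpace H] [NormedSpace ℝ H] [IsScalarTower ℝ 𝕜 H]
  {A : H →ₗ.[𝕜] H} {K : H →L[𝕜] H} {m : ℕ} {B : Fin m → H →ₗ.[𝕜] H} {α : Fin m → ℝ}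
  {κ T : ℝ} {f u : ℝ → H} {u₀ : H} {L : Fin m → H →L[𝕜] H}

lemma IsSolution.apply_convolution (hu : IsSolution A B α κ T f u₀ u)
    (hL : ∀ j, ∀ w ∈ A.domain, K (app (B j) w) = L j w) {t : ℝ} (ht : t ∈ Ioc 0 T) :
    K (∑ j, ∫ s in (0 : ℝ)..t, kernel κ (α j) (t - s) • app (B j) (u s)) =
      conv (operatorKernel κ α fun j => (L j).restrictScalars ℝ) u t := by
  have heq : ∀ j, EqOn (fun s => (K.restrictScalars ℝ) (kernel κ (α j) (t - s) • app (B j) (u s)))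
      (fun s => kernel κ (α j) (t - s) • L j (u s)) (Ioc 0 t) := by
    intro j s hs
    simp only [map_smul, ContinuousLinearMap.coe_restrictScalars']
    rw [hL j _ (hu.mem_domain s ⟨hs.1, hs.2.trans ht.2⟩)]
  have hint : ∀ j, IntervalIntegrable (fun s => kernel κ (α j) (t - s) • L j (u s)) volume 0 t := by
    intro j
    have h := hu.integrable j t ht
    refine IntervalIntegrable.congr (fun s hs => heq j (by rwa [uIoc_of_le ht.1.le] at hs))
      ⟨(K.restrictScalars ℝ).integrable_comp h.1, (K.restrictScalars ℝ).integrable_comp h.2⟩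
  rw [map_sum]
  simp only [conv, operatorKernel, sum_apply, smul_apply,
    ContinuousLinearMap.coe_restrictScalars']
  rw [intervalIntegral.integral_finsetSum fun j _ => hint j]
  refine Finset.sum_congr rfl fun j _ => ?_
  have := ContinuousLinearMap.intervalIntegral_comp_comm (K.restrictScalars ℝ)
    (hu.integrable j t ht)
  rw [ContinuousLinearMap.coe_restrictScalars'] at this
  rw [← this]
  exact SmoothingFamily.integral_congr_Ioc (heq j) (right_mem_Ioc.2 ht.1)

/-- A classical solution need not have `u'` integrable near `0`. But `K u` is continuous up to `0`,
and its derivative `K f - u - l * u` is weakly singular, so the fundamental theorem of calculus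
applies to `K u`. -/
lemma IsSolution.integrated_equation {a c : ℝ} (ha0 : 0 < a) (ha1 : a ≤ 1)
    (hK : IsBoundedInverse A K) (hu : IsSolution A B α κ T f u₀ u)
    (hu₀ : u₀ ∈ A.domain) (hf : ContinuousOn f (Icc 0 T))
    (hL : ∀ j, ∀ w ∈ A.domain, K (app (B j) w) = L j w)
    (hl : LipschitzSingular a T c (operatorKernel κ α fun j => (L j).restrictScalars ℝ)) {t : ℝ}
    (ht : t ∈ Ioc 0 T) :
    K (u t) = K (K (app A u₀)) + ∫ s in (0 : ℝ)..t, (K (f s) - u s -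
      conv (operatorKernel κ α fun j => (L j).restrictScalars ℝ) u s) := by
  have hT := ht.1.trans_le ht.2
  obtain ⟨c₁, huw⟩ := exists_weaklySingular_of_continuousOn ha1 hu.continuousOn
  obtain ⟨c₂, hfw⟩ : ∃ c₂, WeaklySingular a T c₂ (fun s => K (f s)) :=
    exists_weaklySingular_of_continuousOn ha1 (K.continuous.comp_continuousOn hf)
  have hlu := WeaklySingular.conv ha0 ha1 hT (hl.weaklySingular ha1) huw
  have h := intervalIntegral.integral_eq_sub_of_hasDerivAt_of_le ht.1.le (f := fun s => K (u s))
    (f' := fun s => K (f s) - u s - conv (operatorKernel κ α fun j => (L j).restrictScalars ℝ) u s)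
    (K.continuous.comp_continuousOn (hu.continuousOn.mono (Icc_subset_Icc_right ht.2)))
    (fun s hs => ?_) (((hfw.sub huw).sub hlu).intervalIntegrable ha0 ht.1.le ht.2)
  · rw [h, hu.initial, hK.apply_app hu₀]
    abel
  · have hs' : s ∈ Ioc 0 T := ⟨hs.1, hs.2.le.trans ht.2⟩
    have hd := (hu.differentiableOn s hs').hasDerivWithinAt.hasDerivAt
      (Ioc_mem_nhds hs.1 (hs.2.trans_le ht.2))
    have hKd := (K.restrictScalars ℝ).hasFDerivAt.comp_hasDerivAt s hd
    refine hKd.congr_deriv ?_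
    rw [← hu.equation s hs', ContinuousLinearMap.coe_restrictScalars', map_add, map_add,
      hu.apply_convolution hL hs', hK.apply_app (hu.mem_domain s hs')]
    abel

end Solution

end TemperedVolterra

/-! ### The regularity estimate for the original problem. -/

theorem theorem2p7 {𝕜 H : Type*} [RCLike 𝕜] [NormedAddCommGroup H] [InnerProductSpace 𝕜 H]
    [CompleteSpace H] [NormedSpace ℝ H] [IsScalarTower ℝ 𝕜 H]
    (A : H →ₗ.[𝕜] H) (hA : TemperedVolterra.IsAdmissible A)
    {m : ℕ} (hm : 1 ≤ m) (B : Fin m → H →ₗ.[𝕜] H)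
    (hB : ∀ j, IsSelfAdjoint (B j)) (hAB : ∀ j, TemperedVolterra.Dominates A (B j))
    (α : Fin m → ℝ) (hα : ∀ j, 0 < α j ∧ α j < 1)
    (κ : ℝ) (hκ : 0 ≤ κ) (T : ℝ) (hT : 0 < T) (R : ℝ) :
    ∃ C : ℝ, 0 < C ∧ ∀ (u₀ : H) (f u : ℝ → H) (M : ℝ),
      TemperedVolterra.DataBound A (⨅ j, α j) T u₀ (fun t => Real.exp (κ * t) • f t) M →
      M ≤ R * TemperedVolterra.scaleNorm A 2 u₀ →
      TemperedVolterra.IsSolution A B α κ T f u₀ u →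
      DifferentiableOn ℝ (derivWithin u (Set.Ioc 0 T)) (Set.Ioc 0 T) ∧
      ∀ t ∈ Set.Ioc 0 T,
        derivWithin u (Set.Ioc 0 T) t ∈ A.domain ∧
        ‖derivWithin (derivWithin u (Set.Ioc 0 T)) (Set.Ioc 0 T) t‖
            + ‖TemperedVolterra.app A (derivWithin u (Set.Ioc 0 T) t)‖
          ≤ C * Real.exp (-κ * t) * t ^ ((⨅ j, α j) - 1)
              * TemperedVolterra.scaleNorm A 2 u₀ := by
  open TemperedVolterra in
  have : Nonempty (Fin m) := ⟨⟨0, hm⟩⟩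
  obtain ⟨j₀, hj₀⟩ := exists_eq_ciInf_of_finite (f := α)
  have hle : ∀ j, ⨅ j, α j ≤ α j := fun j => ciInf_le (Set.finite_range α).bddBelow j
  set a := ⨅ j, α j with ha
  have ha0 : 0 < a := hj₀ ▸ (hα j₀).1
  have ha1 : a ≤ 1 := hj₀ ▸ (hα j₀).2.le
  obtain ⟨K, hKc, hK1, hK2⟩ := hA.compactInverse
  have hK : IsBoundedInverse A K := ⟨hK1, hK2⟩
  have S := smoothingFamily hA hK hKc
  choose Mop Lop hMop hLop using fun j => (hAB j).exists_bounded hA hK (hB j)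
  obtain ⟨c₁, hb₁⟩ := exists_lipschitzSingular_operatorKernel T
    (fun j => (Mop j).restrictScalars ℝ) hκ ha0 fun j => ⟨hle j, (hα j).2⟩
  obtain ⟨c₂, hl₂⟩ := exists_lipschitzSingular_operatorKernel T
    (fun j => (Lop j).restrictScalars ℝ) hκ ha0 fun j => ⟨hle j, (hα j).2⟩
  have hb := hb₁.mono_const (le_max_left c₁ c₂)
  have hl := hl₂.mono_const (le_max_right c₁ c₂)
  have hbl : ∀ t ∈ Set.Ioc 0 T,
      (K.restrictScalars ℝ).comp (operatorKernel κ α (fun j => (Mop j).restrictScalars ℝ) t) =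
      (operatorKernel κ α (fun j => (Lop j).restrictScalars ℝ) t).comp (K.restrictScalars ℝ) := by
    intro t _
    ext y
    simp only [operatorKernel, ContinuousLinearMap.comp_apply, sum_apply,
      smul_apply, map_sum, map_smul, ContinuousLinearMap.coe_restrictScalars']
    refine Finset.sum_congr rfl fun j _ => ?_
    rw [hMop, hLop j _ (hK.mem_domain y)]
  obtain ⟨C, hC, hreg⟩ := S.regularity ha0 ha1 hT hb hl hbl
  set P := 1 + 2 * κ * T + κ * T ^ (1 - a) + κ ^ 2 * (T * T ^ (1 - a)) with hP
  have hTa := Real.rpow_nonneg hT.le (1 - a)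
  have hP1 : 1 ≤ P := by
    have : 0 ≤ 2 * κ * T + κ * T ^ (1 - a) + κ ^ 2 * (T * T ^ (1 - a)) := by positivity
    linarith
  -- The `2` counts the two terms to be estimated, `P` comes from passing from `g` to `f`, and
  -- `exp(κT)` pays for the factor `exp(-κt)`. The final `1` only ensures positivity, since `C` may
  -- vanish.
  refine ⟨2 * (C * (max R 0 * P + 1)) * Real.exp (κ * T) + 1, by positivity,
    fun u₀ f u M hdata hMR hu => ?_⟩
  rw [scaleNorm_two] at hMR ⊢
  set g : ℝ → H := fun t => Real.exp (κ * t) • f t with hg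
  have hM : 0 ≤ M := le_trans (by positivity) (hdata.bound T ⟨hT, le_rfl⟩)
  have hfg : ∀ t, f t = Real.exp (-κ * t) • g t := by
    intro t
    rw [hg, smul_smul, ← Real.exp_add]
    simp
  have hg0 : g 0 = f 0 := by simp [hg]
  have hgd : ∀ t ∈ Set.Ioc 0 T,
      HasDerivWithinAt g (derivWithin g (Set.Ioc 0 T) t) (Set.Ioc 0 T) t := fun t ht =>
    (hdata.differentiableOn t ht).hasDerivWithinAt
  have hF := lipschitzSingular_exp_smul ha1 hκ hT hM hgd
    (fun t ht => (hdata.differentiableOn_deriv t ht).hasDerivWithinAt)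
    (fun t ht => le_trans (le_add_of_nonneg_left (norm_nonneg _)) (hdata.bound t ht))
    (fun t ht => by
      have h1 := hdata.bound_deriv t ht
      have h2 := norm_nonneg (deriv (fun s => semigroup A s (app A u₀ - g 0)) t)
      have h3 := mul_nonneg ht.1.le
        (norm_nonneg (derivWithin (derivWithin g (Set.Ioc 0 T)) (Set.Ioc 0 T) t))
      linarith)
    (fun t ht => by
      have h1 := hdata.bound_deriv t ht
      have h2 := norm_nonneg (deriv (fun s => semigroup A s (app A u₀ - g 0)) t)
      have h3 := norm_nonneg (derivWithin g (Set.Ioc 0 T) t)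
      linarith)
  have hfc : ContinuousOn f (Set.Icc 0 T) :=
    ((by fun_prop : Continuous fun t : ℝ => Real.exp (-κ * t)).continuousOn.smul
      hdata.continuousOn).congr fun t _ => hfg t
  have hfd : ∀ t ∈ Set.Ioc 0 T, HasDerivWithinAt f
      (Real.exp (-κ * t) • (derivWithin g (Set.Ioc 0 T) t - κ • g t)) (Set.Ioc 0 T) t := by
    intro t ht
    have h1 : HasDerivAt (fun t => Real.exp (-κ * t)) (Real.exp (-κ * t) * (-κ * 1)) t :=
      ((hasDerivAt_id t).const_mul (-κ)).exp
    refine ((h1.hasDerivWithinAt.smul (hgd t ht)).congr (fun s _ => hfg s) (hfg t)).congr_deriv ?_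
    rw [smul_sub, smul_smul _ κ (g t), mul_one, mul_neg, neg_smul, sub_eq_add_neg]
  -- Since `E' = -G`, the hypothesis on `E'(t) (A u₀ - g(0))` is exactly the bound on `G(t) u'(0)`
  -- with the formal initial value `u'(0) = f(0) - A u₀`.
  have hw₀ : WeaklySingular a T (M * P) (fun t => genExpOp hA hK t (f 0 - app A u₀)) := by
    refine WeaklySingular.mono_const (c := M) ⟨?_, fun t ht => ?_⟩
      (le_mul_of_one_le_right hM hP1)
    · exact ((continuousOn_genExpOp hA hK).mono fun t ht => ht.1).clm_apply continuousOn_const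
    · have h1 : HasDerivAt (fun s => semigroup A s (app A u₀ - g 0))
          (-genExpOp hA hK t (app A u₀ - g 0)) t := by
        refine (S.hasDerivAt_E (app A u₀ - g 0) ht.1).congr_of_eventuallyEq ?_
        filter_upwards [Ioi_mem_nhds ht.1] with s hs using semigroup_eq_expOp hA hK hs _
      have h2 := hdata.bound_deriv t ht
      rw [h1.deriv, ← map_neg, neg_sub, hg0] at h2
      have h3 := mul_nonneg ht.1.le
        (norm_nonneg (derivWithin (derivWithin g (Set.Ioc 0 T)) (Set.Ioc 0 T) t))
      have h4 := norm_nonneg (derivWithin g (Set.Ioc 0 T) t)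
      linarith
  obtain ⟨z, v, hz, hv, hud, hzd⟩ := hreg (app A u₀) u f _ (M * P) hu.continuousOn hfc hfd hF hw₀
    fun t ht => hu.integrated_equation ha0 ha1 hK hdata.mem_domain hfc hLop hl ht
  have hd1 : ∀ t ∈ Set.Ioc 0 T, derivWithin u (Set.Ioc 0 T) t = K (z t) := fun t ht =>
    derivWithin_Ioc ht (hud t ht)
  have hd2 : ∀ t ∈ Set.Ioc 0 T,
      HasDerivWithinAt (derivWithin u (Set.Ioc 0 T)) (v t) (Set.Ioc 0 T) t := fun t ht =>
    (hzd t ht).congr hd1 (hd1 t ht)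
  refine ⟨fun t ht => (hd2 t ht).differentiableWithinAt, fun t ht => ?_⟩
  rw [derivWithin_Ioc ht (hd2 t ht), hd1 t ht]
  refine ⟨hK.mem_domain _, ?_⟩
  rw [hK.app_apply]
  have hp := Real.rpow_nonneg ht.1.le (a - 1)
  have hn := norm_nonneg (app A u₀)
  have hMn : M * P + ‖app A u₀‖ ≤ (max R 0 * P + 1) * ‖app A u₀‖ := by
    have h1 : M ≤ max R 0 * ‖app A u₀‖ :=
      hMR.trans (mul_le_mul_of_nonneg_right (le_max_left _ _) hn)
    have h2 := mul_le_mul_of_nonneg_right h1 (zero_le_one.trans hP1)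
    calc _ ≤ max R 0 * ‖app A u₀‖ * P + ‖app A u₀‖ := by linarith
      _ = _ := by ring
  have hexp : 1 ≤ Real.exp (κ * T) * Real.exp (-κ * t) := by
    rw [← Real.exp_add]
    refine Real.one_le_exp ?_
    have := mul_le_mul_of_nonneg_left ht.2 hκ
    linarith
  calc ‖v t‖ + ‖z t‖ ≤ 2 * (C * (M * P + ‖app A u₀‖) * t ^ (a - 1)) := by
        have := hz.bound t ht
        have := hv.bound t ht
        linarith
    _ ≤ 2 * (C * ((max R 0 * P + 1) * ‖app A u₀‖) * t ^ (a - 1)) := by gcongr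
    _ = 2 * (C * (max R 0 * P + 1)) * t ^ (a - 1) * ‖app A u₀‖ * 1 := by ring
    _ ≤ 2 * (C * (max R 0 * P + 1)) * t ^ (a - 1) * ‖app A u₀‖ *
        (Real.exp (κ * T) * Real.exp (-κ * t)) := by
        refine mul_le_mul_of_nonneg_left hexp ?_
        positivity
    _ = 2 * (C * (max R 0 * P + 1)) * Real.exp (κ * T) * Real.exp (-κ * t) * t ^ (a - 1) *
        ‖app A u₀‖ := by ring
    _ ≤ _ := by
        refine mul_le_mul_of_nonneg_right (mul_le_mul_of_nonneg_right
          (mul_le_mul_of_nonneg_right (by linarith) (Real.exp_pos _).le) hp) hn
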